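/- **Setting.** Let $d\ge 1$, $n=2^k$ with $k\ge 0$, $K=\{1,\dots,n\}^d$ and $N=|K|=n^d$. We observe $y=\theta^*+\sigma\epsilon$, where $\theta^*\in\mathbb R^K$, $\sigma>0$, and the $\epsilon_s$ ($s\in K$) are independent with mean zero and $\max(\mathbb P[\epsilon_s\ge x],\mathbb P[\epsilon_s\le -x])\le 2e^{-x^2/2}$ for all $x\ge 0$. The points of $K$ are revealed one at a time in a (possibly random) order $\rho(1),\dots,\rho(N)$, a permutation of $K$ which is *non-anticipating*: for every $t$ and $s$, conditionally on $\rho(1),\dots,\rho(t)$ and $y_{\rho(1)},\dots,y_{\rho(t-1)}$, the variable $\epsilon_{\rho(t)}$ is distributed as $\epsilon_s$ on the event $\{\rho(t)=s\}$. In round $t$, first $\rho(t)$ is revealed, then a prediction $\hat\theta_{\rho(t)}$ is made, and then $y_{\rho(t)}$ is revealed. A dyadic interval is a set $((a-1)2^s,a2^s]\cap\mathbb Z$ with $0\le s\le k$, $1\le a\le 2^{k-s}$; a dyadic rectangle is a product of $d$ dyadic intervals, and a dyadic square is such a product with all $d$ intervals of the same length. Let $\mathcal S$ be the set of all dyadic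 rectangles in $K$. For $\lambda>0$ put $T_\lambda(x)=\min\{\max\{x,-\lambda\},\lambda\}$ and $\alpha=1/(8\lambda^2)$. **OMADRE.** Start with $w_{S,1}=1/|\mathcal S|$ for $S\in\mathcal S$. In round $t$ let $A_t$ be the set of $S\in\mathcal S$ containing $\rho(t)$ and, if $t>1$, also some $\rho(t')$ with $t'<t$. For $S\in A_t$ let $\hat y^{(S)}_{\rho(t)}$ be the mean of the $y_{\rho(t')}$ with $t'<t$ and $\rho(t')\in S$ (and $0$ if there are none), and let $\hat w_{S,t}=w_{S,t}/\sum_{S'\in A_t}w_{S',t}$. Predict $$\hat\theta_{\rho(t)}=\sum_{S\in A_t}\hat w_{S,t}\,T_\lambda\big(\hat y^{(S)}_{\rho(t)}\big).$$ Then set $w_{S,t+1}=w_{S,t}$ for $S\notin A_t$, and $w_{S,t+1}=w_{S,t}e^{-\alpha\ell_{S,t}}\big/\sum_{S'\in A_t}\hat w_{S',t}e^{-\alpha\ell_{S',t}}$ for $S\in A_t$, where $\ell_{S,t}=\big(T_\lambda(y_{\rho(t)})-T_\lambda(\hat y^{(S)}_{\rho(t)})\big)^2$. For $\mathsf T\subset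 K$ let $V^*_{\mathsf T}$ be the sum of $|\theta^*_u-\theta^*_v|$ over the edges $\{u,v\}$ of the lattice graph (nearest neighbours) with $u,v\in\mathsf T$. **Theorem.** There is an absolute constant $C>1$ (independent of $d,n,\theta^*,\sigma,\lambda,\rho,\mathsf T$ and the noise distribution) such that in the above setting, for every $\lambda>0$ with $\lambda\ge C\max\big(\sigma\sqrt{\log N},\|\theta^*\|_\infty\big)$ and for every dyadic square $\mathsf T\subset K$, the following holds. * If $d>1$, then $$\mathbb E\,\frac1{|\mathsf T|}\sum_{s\in\mathsf T}(\hat\theta_s-\theta^*_s)^2\le\frac{C}{|\mathsf T|}\Big(\lambda^2(\log 2^dN)^2+\lambda V^*_{\mathsf T}(\log 2^dN)^{3/2}\Big)+\frac{\sigma^2+\lambda^2}{|\mathsf T|^2}.$$ * If $d=1$, then $$\mathbb E\,\frac1{|\mathsf T|}\sum_{s\in\mathsf T}(\hat\theta_s-\theta^*_s)^2\le C\lambda^{4/3}(\log 2N)^{4/3}\Big(\frac{V^*_{\mathsf T}}{|\mathsf T|}\Big)^{2/3}+\frac{C\lambda^2\log 2N}{|\mathsf T|}+\frac{\sigma^2+\lambda^2}{|\mathsf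 T|^2},$$ and if moreover $V^*_{\mathsf T}\ge\lambda\,(|\mathsf T|\log 2N)^{-1/2}$, then $$\mathbb E\,\frac1{|\mathsf T|}\sum_{s\in\mathsf T}(\hat\theta_s-\theta^*_s)^2\le C\lambda^{4/3}(\log 2N)^{4/3}\Big(\frac{V^*_{\mathsf T}}{|\mathsf T|}\Big)^{2/3}+\frac{\sigma^2+\lambda^2}{|\mathsf T|^2}.$$ -/

import Mathlib

open MeasureTheory ProbabilityTheory

noncomputable section

namespace OnlineTV

/-! ### Sequential aggregation of experts over a finite domain -/

section Aggregation

variable {K : Type*} [DecidableEq K] {N : ℕ}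

/-- The truncation map `x ↦ min (max x (-a)) a`. -/
def trunc (a x : ℝ) : ℝ := min (max x (-a)) a

/-- An online rule: for an expert `S`, a set `U` of already revealed points of `S`, and a new point
`s`, a prediction computed from the data `(y u : u ∈ U)`. -/
abbrev OnlineRule (K : Type*) : Type _ :=
  (_S U : Finset K) → (_s : K) → ((u : K) → u ∈ U → ℝ) → ℝ

/-- The points revealed strictly before round `t`. Rounds are numbered from `0`, and `ρ t` is the
point revealed in round `t`. -/
def revealed (ρ : Fin N ≃ K) (t : Fin N) : Finset K :=
  (Finset.Iio t).map ρ.toEmbedding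

/-- The prediction of the expert `S` in round `t`. -/
def expertPred (r : OnlineRule K) (ρ : Fin N ≃ K) (y : K → ℝ) (S : Finset K) (t : Fin N) : ℝ :=
  r S (revealed ρ t ∩ S) (ρ t) (fun u _ => y u)

/-- The experts active in round `t`: those that contain the new point and, except in the first
round, also contain some point revealed before. -/
def active (𝒮 : Finset (Finset K)) (ρ : Fin N ≃ K) (t : Fin N) : Finset (Finset K) :=
  𝒮.filter fun S => ρ t ∈ S ∧ ((t : ℕ) = 0 ∨ ∃ t' : Fin N, t' < t ∧ ρ t' ∈ S)

/-- The loss of the expert `S` in round `t`, with truncated data and truncated prediction. -/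
def expertLoss (r : OnlineRule K) (lam : ℝ) (ρ : Fin N ≃ K) (y : K → ℝ)
    (S : Finset K) (t : Fin N) : ℝ :=
  (trunc lam (y (ρ t)) - trunc lam (expertPred r ρ y S t)) ^ 2

/-- Weights `w` normalised to total mass one over the finite family `A`. -/
def normalized (A : Finset (Finset K)) (w : Finset K → ℝ) (S : Finset K) : ℝ :=
  w S / ∑ S' ∈ A, w S'

/-- The weights of the experts at the beginning of round `t`: they start uniform, and in each round
the active ones are updated exponentially with learning rate `1 / (8 λ²)`. -/
def weight (r : OnlineRule K) (𝒮 : Finset (Finset K)) (lam : ℝ) (ρ : Fin N ≃ K) (y : K → ℝ) :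
    ℕ → Finset K → ℝ
  | 0 => fun _ => 1 / (𝒮.card : ℝ)
  | t + 1 => fun S =>
      if h : t < N then
        if S ∈ active 𝒮 ρ ⟨t, h⟩ then
          weight r 𝒮 lam ρ y t S * Real.exp (-(1 / (8 * lam ^ 2)) * expertLoss r lam ρ y S ⟨t, h⟩) /
            ∑ S' ∈ active 𝒮 ρ ⟨t, h⟩,
              normalized (active 𝒮 ρ ⟨t, h⟩) (weight r 𝒮 lam ρ y t) S' *
                Real.exp (-(1 / (8 * lam ^ 2)) * expertLoss r lam ρ y S' ⟨t, h⟩)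
        else weight r 𝒮 lam ρ y t S
      else weight r 𝒮 lam ρ y t S

/-- The prediction of the aggregation algorithm at the point `s`, made in the round in which `s` is
revealed. -/
def aggregate (r : OnlineRule K) (𝒮 : Finset (Finset K)) (lam : ℝ) (ρ : Fin N ≃ K) (y : K → ℝ)
    (s : K) : ℝ :=
  ∑ S ∈ active 𝒮 ρ (ρ.symm s),
    normalized (active 𝒮 ρ (ρ.symm s)) (weight r 𝒮 lam ρ y (ρ.symm s : ℕ)) S *
      trunc lam (expertPred r ρ y S (ρ.symm s))

/-- The online averaging rule: predict the mean of the data seen so far in `S`. For `U = ∅` the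
quotient is `0 / 0 = 0`, which is the required convention. -/
def meanRule (K : Type*) : OnlineRule K :=
  fun _ U _ y => (∑ u ∈ U.attach, y u.1 u.2) / (U.card : ℝ)

end Aggregation

/-! ### The lattice, dyadic rectangles, total variation -/

/-- The grid `[n]^d`; coordinates are numbered from `0` to `n - 1`. -/
abbrev Grid (d n : ℕ) : Type := Fin d → Fin n

/-- The dyadic interval of length `2^s` with index `a`; in coordinates numbered from `1` it
is `(a 2^s, (a + 1) 2^s]`. -/
def dyadicInterval (k s a : ℕ) : Finset (Fin (2 ^ k)) :=
  Finset.univ.filter fun i => a * 2 ^ s ≤ (i : ℕ) ∧ (i : ℕ) < (a + 1) * 2 ^ s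

/-- A dyadic rectangle: a product of dyadic intervals of `[2^k]`, of possibly different lengths. -/
def IsDyadicRect {d k : ℕ} (R : Finset (Grid d (2 ^ k))) : Prop :=
  ∃ s a : Fin d → ℕ, (∀ i, s i ≤ k ∧ a i < 2 ^ (k - s i)) ∧
    R = Fintype.piFinset fun i => dyadicInterval k (s i) (a i)

/-- A dyadic square: a product of dyadic intervals of `[2^k]` of one common length. -/
def IsDyadicSquare {d k : ℕ} (T : Finset (Grid d (2 ^ k))) : Prop :=
  ∃ (s : ℕ) (a : Fin d → ℕ), (s ≤ k ∧ ∀ i, a i < 2 ^ (k - s)) ∧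
    T = Fintype.piFinset fun i => dyadicInterval k s (a i)

open Classical in
/-- The family of all dyadic rectangles of `[2^k]^d`. -/
def dyadicRects (d k : ℕ) : Finset (Finset (Grid d (2 ^ k))) :=
  Finset.univ.filter IsDyadicRect

/-- The edges of the lattice graph, each one oriented in the increasing direction. -/
def IsEdge {d n : ℕ} (u v : Grid d n) : Prop :=
  ∃ i, (v i : ℕ) = (u i : ℕ) + 1 ∧ ∀ j, j ≠ i → v j = u j

open Classical in
/-- The total variation of the restriction of `θ` to `T`: the sum of `|θ u - θ v|` over the lattice
edges with both ends in `T`. -/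
def tvOn {d n : ℕ} (T : Finset (Grid d n)) (θ : Grid d n → ℝ) : ℝ :=
  ∑ p ∈ (T ×ˢ T).filter fun p => IsEdge p.1 p.2, |θ p.1 - θ p.2|

/-- Online mean aggregation over dyadic rectangles, with truncation level `lam`, on the
data `y` revealed in the order `ρ`. -/
def omadre {d k N : ℕ} (lam : ℝ) (ρ : Fin N ≃ Grid d (2 ^ k)) (y : Grid d (2 ^ k) → ℝ) :
    Grid d (2 ^ k) → ℝ :=
  aggregate (meanRule (Grid d (2 ^ k))) (dyadicRects d k) lam ρ y

/-! ### The noise and the ordering -/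

section Probability

variable {Ω K : Type*} [MeasurableSpace Ω] {N : ℕ}

/-- Independent, centred, sub-Gaussian noise variables with unit dispersion factor. -/
structure IsNoise (μ : Measure Ω) (ε : K → Ω → ℝ) : Prop where
  measurable : ∀ s, Measurable (ε s)
  indep : iIndepFun ε μ
  integrable : ∀ s, Integrable (ε s) μ
  mean_zero : ∀ s, ∫ ω, ε s ω ∂μ = 0
  upper_tail : ∀ s, ∀ x : ℝ, 0 ≤ x → μ.real {ω | x ≤ ε s ω} ≤ 2 * Real.exp (-x ^ 2 / 2)
  lower_tail : ∀ s, ∀ x : ℝ, 0 ≤ x → μ.real {ω | ε s ω ≤ -x} ≤ 2 * Real.exp (-x ^ 2 / 2)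

/-- The observations `y = θ + σ ε`. -/
def observation (θ : K → ℝ) (σ : ℝ) (ε : K → Ω → ℝ) (ω : Ω) (s : K) : ℝ := θ s + σ * ε s ω

/-- The information available just after the point of round `t` is revealed: the points of all
rounds up to and including `t`, and the observations of all rounds before `t`. -/
@[reducible] def history (ρ : Ω → (Fin N ≃ K)) (y : Ω → K → ℝ) (t : Fin N) : MeasurableSpace Ω :=
  (⨆ t' : Fin N, ⨆ _ : t' ≤ t, MeasurableSpace.comap (fun ω => ρ ω t') ⊤) ⊔
    (⨆ t' : Fin N, ⨆ _ : t' < t,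
      MeasurableSpace.comap (fun ω => y ω (ρ ω t')) (inferInstance : MeasurableSpace ℝ))

/-- A random ordering `ρ` (a measurable one) is non-anticipating if, conditionally on the history up
to round `t`, the noise at the point `ρ(t)` has on the event `ρ(t) = s` the law of `ε s`. -/
structure IsNonAnticipating (μ : Measure Ω) (ε : K → Ω → ℝ) (y : Ω → K → ℝ)
    (ρ : Ω → (Fin N ≃ K)) : Prop where
  measurableSet_eq : ∀ t s, MeasurableSet {ω | ρ ω t = s}
  cond_law : ∀ (t : Fin N) (s : K) (B : Set ℝ), MeasurableSet B →
    ∀ᵐ ω ∂μ, ρ ω t = s →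
      (μ⟦{ω' | ε (ρ ω' t) ω' ∈ B} | history ρ y t⟧) ω = μ.real {ω' | ε s ω' ∈ B}

end Probability

end OnlineTV

end

noncomputable section

namespace OnlineTV

/-! ### Truncation -/

/-! The proof combines an oracle inequality, valid for every single expert, with a partition of the
square into dyadic rectangles adapted to the signal.

Oracle inequality (`integral_sum_aggregate_sub_sq_le`). On `[-λ, λ]` the square loss is
exponentially concave with rate `1 / (8 λ²)`, so the logarithm of the weight of an expert `S` is a
potential bounding the regret against `S`, over the rounds when `S` is awake, by `8 λ² log |𝒮|`.
Passing from truncated data to the true signal costs a martingale, whose mean vanishes because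
predictions depend only on the history, and the truncation error, which is exponentially small once
`λ` dominates `σ √(log N)`. What remains is the error of the running mean on `S`. Its bias is at
most `2 sse S θ` for any order of revelation, since each new point raises the sum of squares by at
least half its squared prediction error. Its noise part is bounded by a harmonic sum: the first `j`
noise values seen in `S` are martingale increments, so their sum has second moment at most `20 j`
even though the order may depend on earlier data. Hence the expected total error on `S` is at most
`8 λ² log |𝒮| + 8 λ² + 4 sse S θ`.

Approximation. For `d > 1`, on boxes of aspect ratio at most two, `sse ≤ 2 V²` with a constant free
of the dimension: Efron–Stein splits the variance over the coordinates, and each term is bounded by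
pairing its direction with one other direction. For `d = 1`, trivially `sse ≤ |S| V²`.

Partition (`sum_dyadicBox_le`). Halving the longest side while the variation exceeds `δ` yields
about `1 + V log₂|T| / δ` balanced boxes of variation at most `δ`, because variation is
superadditive over disjoint sets. Summing the oracle inequality over them and choosing `δ = λ √L`
for `d > 1`, or `δ³ = λ² L² V / |T|` for `d = 1`, gives the rates. The remainder `(σ² + λ²) / |T|²`
is not needed and is added only at the end. -/

theorem abs_trunc_le {a : ℝ} (ha : 0 ≤ a) (x : ℝ) : |trunc a x| ≤ a := by
  unfold trunc
  rw [abs_le]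
  refine ⟨le_min (le_max_right _ _) (by linarith), min_le_right _ _⟩

theorem trunc_of_abs_le {a x : ℝ} (h : |x| ≤ a) : trunc a x = x := by
  unfold trunc
  rw [abs_le] at h
  rw [max_eq_left h.1, min_eq_left h.2]

theorem abs_trunc_sub_trunc_le (a x y : ℝ) : |trunc a x - trunc a y| ≤ |x - y| := by
  unfold trunc
  refine (abs_min_sub_min_le_max _ _ _ _).trans ?_
  rw [sub_self, abs_zero]
  refine max_le ((abs_max_sub_max_le_max _ _ _ _).trans ?_) (abs_nonneg _)
  simp

/-- Truncation moves `x` only when `x` is farther than `a - |c|` from `c`, and then by no more than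
the excess. With `c` the signal, only large noise contributes. -/
theorem abs_sub_trunc_le {a x c : ℝ} (hc : |c| ≤ a) : |x - trunc a x| ≤ max (|x - c| - (a - |c|)) 0 := by
  unfold trunc
  have h1 := abs_le.1 hc
  have h2 := le_abs_self c
  have h3 := neg_abs_le c
  rcases le_total x (-a) with h | h
  · rw [max_eq_right h, min_eq_left (by linarith), abs_of_nonpos (by linarith)]
    refine le_max_of_le_left ?_
    have := neg_abs_le (x - c)
    linarith
  · rw [max_eq_left h]
    rcases le_total x a with h' | h'
    · rw [min_eq_left h']; simp
    · rw [min_eq_right h', abs_of_nonneg (by linarith)]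
      refine le_max_of_le_left ?_
      have := le_abs_self (x - c)
      linarith

theorem measurable_trunc (a : ℝ) : Measurable (trunc a) := by
  unfold trunc
  fun_prop

/-! ### Exponential concavity of the square loss -/

/-- The second derivative is `(x² - 1) exp (-x²/2)`, which is nonpositive exactly on this interval.
-/
theorem concaveOn_exp_neg_sq_half :
    ConcaveOn ℝ (Set.Icc (-1 : ℝ) 1) (fun x => Real.exp (-(x ^ 2 / 2))) := by
  have h1 : ∀ x : ℝ, HasDerivAt (fun x => Real.exp (-(x ^ 2 / 2)))
      (-x * Real.exp (-(x ^ 2 / 2))) x := by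
    intro x
    have := (((hasDerivAt_id x).pow 2).div_const 2).neg.exp
    refine (this.congr_deriv ?_).congr_of_eventuallyEq (.of_forall fun x => ?_)
    · simp only [Pi.neg_apply, Pi.pow_apply, id]
      push_cast
      ring
    · simp
  have h2 : ∀ x : ℝ, HasDerivAt (fun x => -x * Real.exp (-(x ^ 2 / 2)))
      ((x ^ 2 - 1) * Real.exp (-(x ^ 2 / 2))) x := by
    intro x
    refine ((hasDerivAt_id x).neg.mul (h1 x)).congr_deriv ?_
    simp only [id, Pi.neg_apply]
    ring
  refine concaveOn_of_hasDerivWithinAt2_nonpos (convex_Icc _ _)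
    (fun x _ => (h1 x).continuousAt.continuousWithinAt)
    (fun x _ => (h1 x).hasDerivWithinAt) (fun x _ => (h2 x).hasDerivWithinAt) ?_
  intro x hx
  rw [interior_Icc] at hx
  refine mul_nonpos_of_nonpos_of_nonneg ?_ (Real.exp_pos _).le
  nlinarith [hx.1, hx.2]

/-- The square loss on `[-a, a]` is exponentially concave with rate `1 / (8 a²)`. -/
theorem sum_mul_exp_le_exp {ι : Type*} (A : Finset ι) (q e : ι → ℝ) {a z : ℝ} (ha : 0 < a)
    (hq : ∀ i ∈ A, 0 ≤ q i) (hq1 : ∑ i ∈ A, q i = 1) (he : ∀ i ∈ A, |e i| ≤ a) (hz : |z| ≤ a) :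
    ∑ i ∈ A, q i * Real.exp (-(1 / (8 * a ^ 2)) * (z - e i) ^ 2)
      ≤ Real.exp (-(1 / (8 * a ^ 2)) * (z - ∑ i ∈ A, q i * e i) ^ 2) := by
  -- Differences of points of `[-a, a]`, divided by `2a`, fall into `[-1, 1]`. This scaling produces
  -- the rate `1 / (8 a²)` and reduces the claim to Jensen's inequality.
  have hrw : ∀ x : ℝ, -(1 / (8 * a ^ 2)) * (z - x) ^ 2 = -(((z - x) / (2 * a)) ^ 2 / 2) := by
    intro x; field_simp; ring
  have key := concaveOn_exp_neg_sq_half.le_map_sum (t := A) (w := q)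
    (p := fun i => (z - e i) / (2 * a)) hq hq1 ?_
  · simp only [smul_eq_mul] at key
    simp only [hrw]
    refine key.trans (le_of_eq ?_)
    congr 4
    simp_rw [mul_div_assoc', ← Finset.sum_div, mul_sub, Finset.sum_sub_distrib, ← Finset.sum_mul,
      hq1, one_mul]
  · intro i hi
    have h1 := abs_le.1 (he i hi)
    have h2 := abs_le.1 hz
    constructor
    · rw [le_div_iff₀ (by positivity)]; linarith
    · rw [div_le_iff₀ (by positivity)]; linarith

/-! ### The regret of the aggregation algorithm -/

section Normalized

variable {K : Type*}

theorem normalized_nonneg {A : Finset (Finset K)} {w : Finset K → ℝ} (hw : ∀ S, 0 < w S)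
    (S : Finset K) : 0 ≤ normalized A w S :=
  div_nonneg (hw S).le (Finset.sum_nonneg fun S _ => (hw S).le)

theorem normalized_pos {A : Finset (Finset K)} {w : Finset K → ℝ} (hw : ∀ S, 0 < w S)
    {S : Finset K} (hS : S ∈ A) : 0 < normalized A w S :=
  div_pos (hw S) (Finset.sum_pos (fun S _ => hw S) ⟨S, hS⟩)

theorem sum_normalized {A : Finset (Finset K)} {w : Finset K → ℝ} (hw : ∀ S, 0 < w S)
    (hA : A.Nonempty) : ∑ S ∈ A, normalized A w S = 1 := by
  unfold normalized
  rw [← Finset.sum_div, div_self (Finset.sum_pos (fun S _ => hw S) hA).ne']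

end Normalized

theorem sum_ite_lt_succ {N j : ℕ} (hj : j < N) (g : Fin N → ℝ) :
    ∑ t : Fin N, (if (t : ℕ) < j + 1 then g t else 0)
      = ∑ t : Fin N, (if (t : ℕ) < j then g t else 0) + g ⟨j, hj⟩ := by
  have : g ⟨j, hj⟩ = ∑ t : Fin N, (if t = ⟨j, hj⟩ then g t else 0) := by simp
  rw [this, ← Finset.sum_add_distrib]
  refine Finset.sum_congr rfl fun t _ => ?_
  by_cases h1 : (t : ℕ) < j
  · have : t ≠ ⟨j, hj⟩ := by rintro rfl; simp at h1
    simp [h1, this, Nat.lt_succ_of_lt h1]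
  · by_cases h2 : t = ⟨j, hj⟩
    · simp [h2]
    · have : ¬ (t : ℕ) < j + 1 := by
        intro h; exact h2 (Fin.ext (by simp; omega))
      simp [h1, h2, this]

section Aggregation

variable {K : Type*} [DecidableEq K] {N : ℕ} (r : OnlineRule K) {𝒮 : Finset (Finset K)}
  {lam : ℝ} (ρ : Fin N ≃ K) (y : K → ℝ)

theorem active_subset (t : Fin N) : active 𝒮 ρ t ⊆ 𝒮 := Finset.filter_subset _ _

theorem weight_succ (t : Fin N) (S : Finset K) :
    weight r 𝒮 lam ρ y (t + 1) S =
      if S ∈ active 𝒮 ρ t then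
        weight r 𝒮 lam ρ y t S * Real.exp (-(1 / (8 * lam ^ 2)) * expertLoss r lam ρ y S t) /
          ∑ S' ∈ active 𝒮 ρ t, normalized (active 𝒮 ρ t) (weight r 𝒮 lam ρ y t) S' *
            Real.exp (-(1 / (8 * lam ^ 2)) * expertLoss r lam ρ y S' t)
      else weight r 𝒮 lam ρ y t S := by
  simp only [weight, t.2, dif_pos, Fin.eta]

theorem weight_succ_of_le {t : ℕ} (ht : N ≤ t) (S : Finset K) :
    weight r 𝒮 lam ρ y (t + 1) S = weight r 𝒮 lam ρ y t S := by
  simp only [weight, not_lt.2 ht, dif_neg, not_false_eq_true]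

theorem weight_pos (h𝒮 : 𝒮.Nonempty) (j : ℕ) (S : Finset K) :
    0 < weight r 𝒮 lam ρ y j S := by
  induction j generalizing S with
  | zero =>
    have := h𝒮.card_pos
    simp only [weight]; positivity
  | succ j ih =>
    rcases lt_or_ge j N with hj | hj
    · have := weight_succ r (𝒮 := 𝒮) (lam := lam) ρ y ⟨j, hj⟩ S
      simp only at this
      rw [this]
      split_ifs with hS
      · refine div_pos (mul_pos (ih S) (Real.exp_pos _)) (Finset.sum_pos ?_ ⟨S, hS⟩)
        intro S' hS'
        exact mul_pos (normalized_pos ih hS') (Real.exp_pos _)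
      · exact ih S
    · rw [weight_succ_of_le r ρ y hj]; exact ih S

/-- The denominator of the update is the average of the exponential factors under the normalised
active weights, so the total mass of the active experts is preserved; sleeping experts keep theirs.
-/
theorem sum_weight (h𝒮 : 𝒮.Nonempty) (j : ℕ) : ∑ S ∈ 𝒮, weight r 𝒮 lam ρ y j S = 1 := by
  induction j with
  | zero =>
    have := h𝒮.card_pos
    simp only [weight, Finset.sum_const, nsmul_eq_mul]
    field_simp
  | succ j ih =>
    rcases lt_or_ge j N with hj | hj
    · have hw := weight_pos r (lam := lam) ρ y h𝒮 j
      set A := active 𝒮 ρ ⟨j, hj⟩ with hA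
      have hAsub : A ⊆ 𝒮 := active_subset ρ _
      rw [← Finset.sum_sdiff hAsub] at ih ⊢
      rw [← ih]
      congr 1
      · refine Finset.sum_congr rfl fun S hS => ?_
        have := weight_succ r (𝒮 := 𝒮) (lam := lam) ρ y ⟨j, hj⟩ S
        simp only at this
        rw [this, if_neg (Finset.mem_sdiff.1 hS).2]
      · rcases A.eq_empty_or_nonempty with h0 | hne
        · simp [h0]
        set D := ∑ S' ∈ A, normalized A (weight r 𝒮 lam ρ y j) S' *
            Real.exp (-(1 / (8 * lam ^ 2)) * expertLoss r lam ρ y S' ⟨j, hj⟩) with hD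
        have hDpos : 0 < D := Finset.sum_pos
          (fun S' hS' => mul_pos (normalized_pos hw hS') (Real.exp_pos _)) hne
        have hWpos : 0 < ∑ S ∈ A, weight r 𝒮 lam ρ y j S :=
          Finset.sum_pos (fun S _ => hw S) hne
        have h1 : ∀ S ∈ A, weight r 𝒮 lam ρ y (j + 1) S =
            (∑ S ∈ A, weight r 𝒮 lam ρ y j S) / D * (normalized A (weight r 𝒮 lam ρ y j) S *
            Real.exp (-(1 / (8 * lam ^ 2)) * expertLoss r lam ρ y S ⟨j, hj⟩)) := by
          intro S hS
          have := weight_succ r (𝒮 := 𝒮) (lam := lam) ρ y ⟨j, hj⟩ S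
          simp only at this
          rw [this, if_pos hS, ← hA, ← hD]
          unfold normalized
          field_simp
        rw [Finset.sum_congr rfl h1, ← Finset.mul_sum, ← hD]
        field_simp
    · simp_rw [weight_succ_of_le r ρ y hj]; exact ih

theorem weight_le_one (h𝒮 : 𝒮.Nonempty) (j : ℕ) {S : Finset K} (hS : S ∈ 𝒮) :
    weight r 𝒮 lam ρ y j S ≤ 1 := by
  rw [← sum_weight r (lam := lam) ρ y h𝒮 j]
  exact Finset.single_le_sum (fun S _ => (weight_pos r ρ y h𝒮 j S).le) hS

theorem aggregate_apply (t : Fin N) :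
    aggregate r 𝒮 lam ρ y (ρ t) =
      ∑ S ∈ active 𝒮 ρ t, normalized (active 𝒮 ρ t) (weight r 𝒮 lam ρ y t) S *
        trunc lam (expertPred r ρ y S t) := by
  simp [aggregate]

theorem abs_aggregate_le (h𝒮 : 𝒮.Nonempty) (hlam : 0 ≤ lam) (s : K) :
    |aggregate r 𝒮 lam ρ y s| ≤ lam := by
  unfold aggregate
  rcases (active 𝒮 ρ (ρ.symm s)).eq_empty_or_nonempty with h0 | hne
  · simp [h0, hlam]
  have hw := weight_pos r (lam := lam) ρ y h𝒮 (ρ.symm s)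
  refine (Finset.abs_sum_le_sum_abs _ _).trans ?_
  calc _ ≤ ∑ S ∈ active 𝒮 ρ (ρ.symm s),
        normalized (active 𝒮 ρ (ρ.symm s)) (weight r 𝒮 lam ρ y (ρ.symm s : ℕ)) S * lam := by
        refine Finset.sum_le_sum fun S _ => ?_
        rw [abs_mul, abs_of_nonneg (normalized_nonneg hw S)]
        exact mul_le_mul_of_nonneg_left (abs_trunc_le hlam _) (normalized_nonneg hw S)
    _ = lam := by rw [← Finset.sum_mul, sum_normalized hw hne, one_mul]

/-- The cumulative excess loss of the aggregate over a sleeping expert, over the rounds in which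
the expert is active. -/
theorem sum_active_regret_le (hlam : 0 < lam) {S : Finset K} (hS : S ∈ 𝒮) :
    ∑ t : Fin N, (if S ∈ active 𝒮 ρ t then
        (trunc lam (y (ρ t)) - aggregate r 𝒮 lam ρ y (ρ t)) ^ 2 - expertLoss r lam ρ y S t else 0)
      ≤ 8 * lam ^ 2 * Real.log (𝒮.card : ℝ) := by
  have h𝒮 : 𝒮.Nonempty := ⟨S, hS⟩
  have hcard : (0 : ℝ) < 𝒮.card := by exact_mod_cast h𝒮.card_pos
  set g : Fin N → ℝ := fun t => if S ∈ active 𝒮 ρ t then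
    (trunc lam (y (ρ t)) - aggregate r 𝒮 lam ρ y (ρ t)) ^ 2 - expertLoss r lam ρ y S t else 0
    with hg
  -- The potential is `log w_S`. When `S` is active it grows by `-α ℓ_S - log D`, and exponential
  -- concavity bounds `-log D` below by `α` times the loss of the aggregate. It starts at `-log |𝒮|`
  -- and ends at most at zero.
  have key : ∀ j ≤ N, 1 / (8 * lam ^ 2) * ∑ t : Fin N, (if (t : ℕ) < j then g t else 0)
      ≤ Real.log (weight r 𝒮 lam ρ y j S) + Real.log (𝒮.card : ℝ) := by
    intro j
    induction j with
    | zero =>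
      intro _
      simp [weight]
    | succ j ih =>
      intro hj
      have ih := ih (by omega)
      rw [sum_ite_lt_succ hj, mul_add]
      have hw := weight_pos r (lam := lam) ρ y h𝒮 j
      have hsucc := weight_succ r (𝒮 := 𝒮) (lam := lam) ρ y ⟨j, hj⟩ S
      simp only at hsucc
      rw [hsucc]
      by_cases hA : S ∈ active 𝒮 ρ ⟨j, hj⟩
      · simp only [hg, if_pos hA]
        set D := ∑ S' ∈ active 𝒮 ρ ⟨j, hj⟩,
          normalized (active 𝒮 ρ ⟨j, hj⟩) (weight r 𝒮 lam ρ y j) S' *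
            Real.exp (-(1 / (8 * lam ^ 2)) * expertLoss r lam ρ y S' ⟨j, hj⟩) with hD
        have hDpos : 0 < D := Finset.sum_pos
          (fun S' hS' => mul_pos (normalized_pos hw hS') (Real.exp_pos _)) ⟨S, hA⟩
        have hDle : D ≤ Real.exp (-(1 / (8 * lam ^ 2)) *
            (trunc lam (y (ρ ⟨j, hj⟩)) - aggregate r 𝒮 lam ρ y (ρ ⟨j, hj⟩)) ^ 2) := by
          rw [aggregate_apply]
          exact sum_mul_exp_le_exp _ _ _ hlam (fun S _ => normalized_nonneg hw S)
            (sum_normalized hw ⟨S, hA⟩) (fun S _ => abs_trunc_le hlam.le _)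
            (abs_trunc_le hlam.le _)
        have hlog := (Real.log_le_log hDpos hDle).trans_eq (Real.log_exp _)
        rw [Real.log_div (mul_pos (hw S) (Real.exp_pos _)).ne' hDpos.ne',
          Real.log_mul (hw S).ne' (Real.exp_pos _).ne', Real.log_exp]
        linarith
      · simp only [hg, if_neg hA, mul_zero, add_zero]
        exact ih
  have hN := key N le_rfl
  have hlog : Real.log (weight r 𝒮 lam ρ y N S) ≤ 0 :=
    Real.log_nonpos (weight_pos r ρ y h𝒮 N S).le (weight_le_one r ρ y h𝒮 N hS)
  simp only [Fin.is_lt, if_true] at hN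
  have h8 : 0 < 8 * lam ^ 2 := by positivity
  rw [one_div, inv_mul_le_iff₀ h8] at hN
  refine hN.trans ?_
  gcongr
  linarith

end Aggregation

/-! ### Means and sums of squared errors -/

section Mean

variable {K : Type*}

/-- The mean of `x` over `U`, which is zero if `U` is empty. -/
def mean (U : Finset K) (x : K → ℝ) : ℝ := (∑ u ∈ U, x u) / (U.card : ℝ)

/-- The sum of the squared deviations of `x` from its mean over `U`. -/
def sse (U : Finset K) (x : K → ℝ) : ℝ := ∑ u ∈ U, (x u - mean U x) ^ 2

theorem sse_nonneg (U : Finset K) (x : K → ℝ) : 0 ≤ sse U x :=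
  Finset.sum_nonneg fun _ _ => sq_nonneg _

theorem mean_add (U : Finset K) (x z : K → ℝ) : mean U (fun u => x u + z u) = mean U x + mean U z := by
  simp only [mean, Finset.sum_add_distrib, add_div]

theorem mean_const_mul (U : Finset K) (c : ℝ) (x : K → ℝ) :
    mean U (fun u => c * x u) = c * mean U x := by
  simp only [mean, ← Finset.mul_sum, mul_div_assoc]

theorem card_mul_mean {U : Finset K} (hU : U.Nonempty) (x : K → ℝ) :
    (U.card : ℝ) * mean U x = ∑ u ∈ U, x u := by
  have : (U.card : ℝ) ≠ 0 := by exact_mod_cast hU.card_pos.ne'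
  unfold mean
  field_simp

theorem sum_sub_sq_eq (U : Finset K) (x : K → ℝ) (c : ℝ) :
    ∑ u ∈ U, (x u - c) ^ 2 = sse U x + U.card * (mean U x - c) ^ 2 := by
  rcases U.eq_empty_or_nonempty with rfl | hU
  · simp [sse]
  have h := card_mul_mean hU x
  have h1 : ∀ u ∈ U, (x u - c) ^ 2 = (x u - mean U x) ^ 2
      + 2 * (mean U x - c) * x u + (c ^ 2 - mean U x ^ 2) := fun u _ => by ring
  rw [Finset.sum_congr rfl h1, Finset.sum_add_distrib, Finset.sum_add_distrib, ← Finset.mul_sum,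
    ← h, Finset.sum_const, nsmul_eq_mul]
  unfold sse
  ring

theorem sse_le_sum_sub_sq (U : Finset K) (x : K → ℝ) (c : ℝ) :
    sse U x ≤ ∑ u ∈ U, (x u - c) ^ 2 := by
  rw [sum_sub_sq_eq]
  have : 0 ≤ (U.card : ℝ) * (mean U x - c) ^ 2 := by positivity
  linarith

/-- The exact increment carries the factor `|U| / (|U| + 1)`, which is at least `1/2` for nonempty
`U`. -/
theorem sse_add_le_sse_insert [DecidableEq K] {U : Finset K} (hU : U.Nonempty) (x : K → ℝ) {s : K}
    (hs : s ∉ U) : sse U x + (x s - mean U x) ^ 2 / 2 ≤ sse (insert s U) x := by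
  have hn : (1 : ℝ) ≤ U.card := by exact_mod_cast hU.card_pos
  rw [sse.eq_1 (insert s U), Finset.sum_insert hs, sum_sub_sq_eq]
  generalize mean (insert s U) x = m
  have : (x s - mean U x) ^ 2 / 2 ≤ (x s - m) ^ 2 + (mean U x - m) ^ 2 := by
    nlinarith [sq_nonneg ((x s - m) + (mean U x - m))]
  nlinarith [mul_nonneg (sub_nonneg.2 hn) (sq_nonneg (mean U x - m))]

end Mean

section Rounds

variable {K : Type*} [DecidableEq K] {N : ℕ} (ρ : Fin N ≃ K)

theorem mem_revealed_inter {S : Finset K} {t : Fin N} {u : K} :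
    u ∈ revealed ρ t ∩ S ↔ ρ.symm u < t ∧ u ∈ S := by
  simp only [revealed, Finset.mem_inter, Finset.mem_map, Finset.mem_Iio, Equiv.coe_toEmbedding]
  constructor
  · rintro ⟨⟨t', h, rfl⟩, hS⟩; simpa using ⟨h, hS⟩
  · rintro ⟨h, hS⟩; exact ⟨⟨_, h, by simp⟩, hS⟩

theorem revealed_inter_nonempty_iff {S : Finset K} {t : Fin N} :
    (revealed ρ t ∩ S).Nonempty ↔ ∃ t' : Fin N, t' < t ∧ ρ t' ∈ S := by
  constructor
  · rintro ⟨u, hu⟩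
    rw [mem_revealed_inter] at hu
    exact ⟨_, hu.1, by simpa using hu.2⟩
  · rintro ⟨t', h, hS⟩
    exact ⟨ρ t', by rw [mem_revealed_inter]; simpa using ⟨h, hS⟩⟩

theorem expertPred_meanRule (y : K → ℝ) (S : Finset K) (t : Fin N) :
    expertPred (meanRule K) ρ y S t = mean (revealed ρ t ∩ S) y := by
  simp only [expertPred, meanRule, mean]
  rw [Finset.sum_attach (revealed ρ t ∩ S) y]

/-- Only the first arrival in `S` finds no earlier data there. This is the one round whose error
must be bounded crudely. -/
theorem sum_first_le_one (S : Finset K) :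
    ∑ t : Fin N, (if ρ t ∈ S ∧ ¬ (revealed ρ t ∩ S).Nonempty then (1 : ℝ) else 0) ≤ 1 := by
  rw [← Finset.sum_filter, Finset.sum_const, nsmul_eq_mul, mul_one]
  have : (Finset.univ.filter fun t : Fin N =>
      ρ t ∈ S ∧ ¬ (revealed ρ t ∩ S).Nonempty).card ≤ 1 := by
    rw [Finset.card_le_one]
    intro t ht t' ht'
    simp only [Finset.mem_filter, Finset.mem_univ, true_and, revealed_inter_nonempty_iff] at ht ht'
    by_contra hne
    rcases lt_or_gt_of_ne hne with h | h
    · exact ht'.2 ⟨t, h, ht.1⟩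
    · exact ht.2 ⟨t', h, ht'.1⟩
  exact_mod_cast this

/-- The squared errors of the running mean, over an arbitrary order, are controlled by the total
squared deviation from the overall mean. -/
theorem sum_sub_running_mean_sq_le (S : Finset K) (x : K → ℝ) :
    ∑ t : Fin N, (if ρ t ∈ S ∧ (revealed ρ t ∩ S).Nonempty then
      (x (ρ t) - mean (revealed ρ t ∩ S) x) ^ 2 else 0) ≤ 2 * sse S x := by
  set g : Fin N → ℝ := fun t => if ρ t ∈ S ∧ (revealed ρ t ∩ S).Nonempty then
      (x (ρ t) - mean (revealed ρ t ∩ S) x) ^ 2 else 0 with hg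
  have key : ∀ j ≤ N, ∑ t : Fin N, (if (t : ℕ) < j then g t else 0)
      ≤ 2 * sse (S.filter fun s => (ρ.symm s : ℕ) < j) x := by
    intro j
    induction j with
    | zero => simp [sse]
    | succ j ih =>
      intro hj
      have ih := ih (by omega)
      have hU : revealed ρ ⟨j, hj⟩ ∩ S = S.filter fun s => (ρ.symm s : ℕ) < j := by
        ext u
        rw [mem_revealed_inter, Finset.mem_filter, Fin.lt_def, and_comm]
      rw [sum_ite_lt_succ hj]
      by_cases hS : ρ ⟨j, hj⟩ ∈ S
      · have hins : (S.filter fun s => (ρ.symm s : ℕ) < j + 1)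
            = insert (ρ ⟨j, hj⟩) (S.filter fun s => (ρ.symm s : ℕ) < j) := by
          ext u
          simp only [Finset.mem_filter, Finset.mem_insert]
          have hu : u = ρ ⟨j, hj⟩ ↔ (ρ.symm u : ℕ) = j := by
            rw [← Equiv.symm_apply_eq, Fin.ext_iff]
          constructor
          · rintro ⟨h1, h2⟩
            rcases Nat.lt_succ_iff_lt_or_eq.1 h2 with h | h
            · exact Or.inr ⟨h1, h⟩
            · exact Or.inl (hu.2 h)
          · rintro (h | ⟨h1, h2⟩)
            · exact ⟨h ▸ hS, by rw [hu.1 h]; omega⟩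
            · exact ⟨h1, by omega⟩
        have hnot : ρ ⟨j, hj⟩ ∉ S.filter fun s => (ρ.symm s : ℕ) < j := by simp
        rw [hins]
        simp only [hg, hS, true_and, hU] at ih ⊢
        by_cases hne : (S.filter fun s => (ρ.symm s : ℕ) < j).Nonempty
        · rw [if_pos hne]
          have := sse_add_le_sse_insert hne x hnot
          linarith
        · rw [if_neg hne]
          rw [Finset.not_nonempty_iff_eq_empty] at hne
          rw [hne] at ih
          have h0 : sse (∅ : Finset K) x = 0 := by simp [sse]
          have := sse_nonneg (insert (ρ ⟨j, hj⟩) (∅ : Finset K)) x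
          rw [hne]
          linarith
      · have hins : (S.filter fun s => (ρ.symm s : ℕ) < j + 1)
            = S.filter fun s => (ρ.symm s : ℕ) < j := by
          refine Finset.filter_congr fun u hu => ?_
          have : (ρ.symm u : ℕ) ≠ j := by
            intro h
            apply hS
            have : ρ.symm u = ⟨j, hj⟩ := Fin.ext h
            rw [← this]; simpa using hu
          omega
        rw [hins]
        simpa [hg, hS] using ih
  have hN := key N le_rfl
  simpa using hN

/-- A bound for the total squared error of the aggregate over the points of one expert: a
deterministic part, the squared running means of the noise, the truncation error of the data, and
a martingale. -/
theorem sum_aggregate_sub_sq_le {𝒮 : Finset (Finset K)} {lam : ℝ} (hlam : 0 < lam)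
    {S : Finset K} (hS : S ∈ 𝒮) {y θ η : K → ℝ} (hy : ∀ s, y s = θ s + η s)
    (hθ : ∀ s, |θ s| ≤ lam) :
    ∑ s ∈ S, (aggregate (meanRule K) 𝒮 lam ρ y s - θ s) ^ 2
      ≤ 8 * lam ^ 2 * Real.log (𝒮.card : ℝ) + 4 * lam ^ 2 + 4 * sse S θ
        + 2 * ∑ t : Fin N, (if ρ t ∈ S ∧ (revealed ρ t ∩ S).Nonempty then
            mean (revealed ρ t ∩ S) η ^ 2 else 0)
        + 4 * lam * ∑ s ∈ S, |y s - trunc lam (y s)|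
        + 2 * ∑ t : Fin N, (if S ∈ active 𝒮 ρ t then
            aggregate (meanRule K) 𝒮 lam ρ y (ρ t) - trunc lam (mean (revealed ρ t ∩ S) y) else 0)
              * η (ρ t) := by
  have h𝒮 : 𝒮.Nonempty := ⟨S, hS⟩
  have hconv : ∀ f : K → ℝ, ∑ s ∈ S, f s = ∑ t : Fin N, if ρ t ∈ S then f (ρ t) else 0 := by
    intro f
    rw [← Finset.sum_filter]
    symm
    refine Finset.sum_bij (fun t _ => ρ t) (by simp) (by simp) ?_ (by simp)
    intro s hs
    exact ⟨ρ.symm s, by simpa using hs, by simp⟩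
  rw [hconv, hconv]
  have hreg := sum_active_regret_le (meanRule K) ρ y hlam hS
  have hfirst := sum_first_le_one ρ S
  have hbias := sum_sub_running_mean_sq_le ρ S θ
  -- With `p` the aggregate, `e` the truncated expert and `z` the truncated observation, `(p - θ)² -
  -- (e - θ)² = (z - p)² - (z - e)² + 2 (p - e) η + 2 (y - z) (e - p)`. Truncation is 1-Lipschitz
  -- and fixes `θ`, so `(e - θ)²` is at most twice the squared bias plus twice the squared mean
  -- noise.
  have hround : ∀ t : Fin N, (if ρ t ∈ S then
      (aggregate (meanRule K) 𝒮 lam ρ y (ρ t) - θ (ρ t)) ^ 2 else 0) ≤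
      (if S ∈ active 𝒮 ρ t then (trunc lam (y (ρ t)) - aggregate (meanRule K) 𝒮 lam ρ y (ρ t)) ^ 2
        - expertLoss (meanRule K) lam ρ y S t else 0)
      + 4 * lam ^ 2 * (if ρ t ∈ S ∧ ¬ (revealed ρ t ∩ S).Nonempty then (1 : ℝ) else 0)
      + 2 * (if ρ t ∈ S ∧ (revealed ρ t ∩ S).Nonempty then
          (θ (ρ t) - mean (revealed ρ t ∩ S) θ) ^ 2 else 0)
      + 2 * (if ρ t ∈ S ∧ (revealed ρ t ∩ S).Nonempty then
            mean (revealed ρ t ∩ S) η ^ 2 else 0)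
      + 4 * lam * (if ρ t ∈ S then |y (ρ t) - trunc lam (y (ρ t))| else 0)
      + 2 * ((if S ∈ active 𝒮 ρ t then
            aggregate (meanRule K) 𝒮 lam ρ y (ρ t) - trunc lam (mean (revealed ρ t ∩ S) y) else 0)
              * η (ρ t)) := by
    intro t
    have hact : S ∈ active 𝒮 ρ t ↔
        ρ t ∈ S ∧ ((t : ℕ) = 0 ∨ (revealed ρ t ∩ S).Nonempty) := by
      rw [revealed_inter_nonempty_iff]
      simp [active, hS]
    have hp := abs_le.1 (abs_aggregate_le (meanRule K) (lam := lam) ρ y h𝒮 hlam.le (ρ t))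
    have hth := abs_le.1 (hθ (ρ t))
    by_cases hmem : ρ t ∈ S
    swap
    · have : S ∉ active 𝒮 ρ t := by rw [hact]; tauto
      simp [hmem, this]
    simp only [hact, hmem, true_and, if_true, expertLoss, expertPred_meanRule]
    have hdev : mean (revealed ρ t ∩ S) y
        = mean (revealed ρ t ∩ S) θ + mean (revealed ρ t ∩ S) η := by
      rw [← mean_add]; congr 1; exact funext hy
    have he := abs_le.1 (abs_trunc_le hlam.le (mean (revealed ρ t ∩ S) y))
    have hyt := hy (ρ t)
    have hlip := abs_trunc_sub_trunc_le lam (θ (ρ t)) (mean (revealed ρ t ∩ S) y)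
    rw [trunc_of_abs_le (hθ _)] at hlip
    have hlip2 := sq_le_sq.2 hlip
    generalize aggregate (meanRule K) 𝒮 lam ρ y (ρ t) = p at *
    generalize trunc lam (mean (revealed ρ t ∩ S) y) = e at *
    generalize hz : trunc lam (y (ρ t)) = z at *
    generalize y (ρ t) = yt at *
    generalize θ (ρ t) = th at *
    generalize η (ρ t) = et at *
    have hyz := le_abs_self (yt - z)
    have hyz' := neg_abs_le (yt - z)
    have h0 := abs_nonneg (yt - z)
    have hcross : 2 * (yt - z) * (e - p) ≤ 4 * lam * |yt - z| := by
      have : (yt - z) * (e - p) ≤ |yt - z| * (2 * lam) := by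
        refine (le_abs_self _).trans ?_
        rw [abs_mul]
        refine mul_le_mul_of_nonneg_left (abs_le.2 ⟨?_, ?_⟩) h0 <;> linarith
      linarith
    by_cases hne : (revealed ρ t ∩ S).Nonempty
    · simp only [hne, or_true, if_true, not_true, if_false]
      rw [hdev] at hlip2
      generalize mean (revealed ρ t ∩ S) θ = m1 at *
      generalize mean (revealed ρ t ∩ S) η = m2 at *
      subst hyt
      nlinarith [sq_nonneg (th - m1 + m2)]
    -- First arrival in `S`: the expert is active only in round `0`. Either way the prediction to be
    -- bounded lies in `[-λ, λ]`, as does `θ`, which costs at most `4 λ²`.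
    · simp only [hne, or_false, if_true, not_false_eq_true, if_false]
      have hsq : ∀ x, -lam ≤ x → x ≤ lam → (x - th) ^ 2 ≤ 4 * lam ^ 2 := by
        intro x h1 h2
        nlinarith
      split_ifs with h
      · have := hsq e he.1 he.2
        subst hyt
        nlinarith
      · have := hsq p hp.1 hp.2
        have : 0 ≤ 4 * lam * |yt - z| := by positivity
        linarith
  refine (Finset.sum_le_sum fun t _ => hround t).trans ?_
  simp only [Finset.sum_add_distrib, ← Finset.mul_sum]
  have : 4 * lam ^ 2 * ∑ t : Fin N, (if ρ t ∈ S ∧ ¬ (revealed ρ t ∩ S).Nonempty then (1 : ℝ) else 0)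
      ≤ 4 * lam ^ 2 * 1 := mul_le_mul_of_nonneg_left hfirst (by positivity)
  linarith

end Rounds

/-! ### Exponential moments of the noise -/

section Tails

variable {Ω : Type*} [MeasurableSpace Ω] {μ : Measure Ω} [IsProbabilityMeasure μ] {X : Ω → ℝ}

/-- Layer cake: with `x = 2 √(log t)` the two tails give `4 t⁻²` for `t > 1`. The range up to `1`
contributes `1` and the rest contributes `4`. -/
theorem lintegral_exp_sq_le (hu : ∀ x : ℝ, 0 ≤ x → μ.real {ω | x ≤ X ω} ≤ 2 * Real.exp (-x ^ 2 / 2))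
    (hl : ∀ x : ℝ, 0 ≤ x → μ.real {ω | X ω ≤ -x} ≤ 2 * Real.exp (-x ^ 2 / 2))
    (hX : Measurable X) :
    ∫⁻ ω, ENNReal.ofReal (Real.exp (X ω ^ 2 / 4)) ∂μ ≤ ENNReal.ofReal 5 := by
  have hmeas : Measurable fun ω => Real.exp (X ω ^ 2 / 4) := by fun_prop
  rw [lintegral_eq_lintegral_meas_lt μ (.of_forall fun ω => (Real.exp_pos _).le)
    hmeas.aemeasurable]
  have htail : ∀ t : ℝ, 1 < t → μ {ω | t < Real.exp (X ω ^ 2 / 4)}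
      ≤ ENNReal.ofReal (4 * t ^ (-2 : ℝ)) := by
    intro t ht
    have hlog : 0 < Real.log t := Real.log_pos ht
    set x := 2 * Real.sqrt (Real.log t) with hx
    have hx0 : 0 ≤ x := by positivity
    have hx2 : x ^ 2 = 4 * Real.log t := by
      rw [hx, mul_pow, Real.sq_sqrt hlog.le]; norm_num
    have hsub : {ω | t < Real.exp (X ω ^ 2 / 4)} ⊆ {ω | x ≤ X ω} ∪ {ω | X ω ≤ -x} := by
      intro ω hω
      simp only [Set.mem_ofPred_eq] at hω
      have h1 : Real.log t < X ω ^ 2 / 4 := (Real.log_lt_iff_lt_exp (by linarith)).2 hω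
      have h2 : x ≤ |X ω| := by
        rw [← abs_of_nonneg hx0, ← sq_le_sq]; linarith
      rcases le_abs.1 h2 with h | h
      · exact Or.inl h
      · exact Or.inr (by simp only [Set.mem_ofPred_eq]; linarith)
    have hexp : Real.exp (-x ^ 2 / 2) = t ^ (-2 : ℝ) := by
      rw [Real.rpow_def_of_pos (by linarith), neg_div, hx2]; ring_nf
    have h3 : μ.real {ω | t < Real.exp (X ω ^ 2 / 4)} ≤ 4 * t ^ (-2 : ℝ) := by
      refine (measureReal_mono hsub).trans ((measureReal_union_le _ _).trans ?_)
      have := hu x hx0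
      have := hl x hx0
      rw [hexp] at *
      linarith
    rw [← ofReal_measureReal]
    exact ENNReal.ofReal_le_ofReal h3
  have hsplit : Set.Ioi (0 : ℝ) = Set.Ioc 0 1 ∪ Set.Ioi 1 := by
    rw [Set.Ioc_union_Ioi_eq_Ioi zero_le_one]
  rw [hsplit]
  refine (lintegral_union_le _ _ _).trans ?_
  have h1 : ∫⁻ t in Set.Ioc (0 : ℝ) 1, μ {ω | t < Real.exp (X ω ^ 2 / 4)} ≤ ENNReal.ofReal 1 := by
    refine (lintegral_mono (g := fun _ => 1) fun t => prob_le_one).trans ?_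
    simp
  have h2 : ∫⁻ t in Set.Ioi (1 : ℝ), μ {ω | t < Real.exp (X ω ^ 2 / 4)} ≤ ENNReal.ofReal 4 := by
    refine (setLIntegral_mono' (g := fun t => ENNReal.ofReal (4 * t ^ (-2 : ℝ)))
      measurableSet_Ioi fun t ht => htail t ht).trans ?_
    rw [← ofReal_integral_eq_lintegral_ofReal]
    · rw [integral_const_mul, integral_Ioi_rpow_of_lt (by norm_num) one_pos]
      norm_num
    · exact (integrableOn_Ioi_rpow_of_lt (by norm_num) one_pos).const_mul 4
    · filter_upwards [ae_restrict_mem measurableSet_Ioi] with t ht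
      have : (0 : ℝ) < t := lt_trans one_pos ht
      positivity
  refine (add_le_add h1 h2).trans ?_
  rw [← ENNReal.ofReal_add (by norm_num) (by norm_num)]
  norm_num

variable (hu : ∀ x : ℝ, 0 ≤ x → μ.real {ω | x ≤ X ω} ≤ 2 * Real.exp (-x ^ 2 / 2))
    (hl : ∀ x : ℝ, 0 ≤ x → μ.real {ω | X ω ≤ -x} ≤ 2 * Real.exp (-x ^ 2 / 2))
    (hX : Measurable X)

include hu hl hX

theorem integrable_exp_sq : Integrable (fun ω => Real.exp (X ω ^ 2 / 4)) μ := by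
  refine ⟨Measurable.aestronglyMeasurable (by fun_prop), ?_⟩
  rw [hasFiniteIntegral_iff_ofReal (.of_forall fun ω => (Real.exp_pos _).le)]
  exact (lintegral_exp_sq_le hu hl hX).trans_lt ENNReal.ofReal_lt_top

theorem integral_exp_sq_le : ∫ ω, Real.exp (X ω ^ 2 / 4) ∂μ ≤ 5 := by
  rw [integral_eq_lintegral_of_nonneg_ae (.of_forall fun ω => (Real.exp_pos _).le)
    (Measurable.aestronglyMeasurable (by fun_prop))]
  exact ENNReal.toReal_le_of_le_ofReal (by norm_num) (lintegral_exp_sq_le hu hl hX)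

omit [IsProbabilityMeasure μ] hu hl hX in
theorem sq_le_exp_sq (x : ℝ) : x ^ 2 ≤ 4 * Real.exp (x ^ 2 / 4) := by
  have := Real.add_one_le_exp (x ^ 2 / 4)
  linarith

theorem integrable_sq_of_tail : Integrable (fun ω => X ω ^ 2) μ := by
  refine ((integrable_exp_sq hu hl hX).const_mul 4).mono'
    (Measurable.aestronglyMeasurable (by fun_prop)) (.of_forall fun ω => ?_)
  rw [Real.norm_of_nonneg (sq_nonneg _)]
  exact sq_le_exp_sq _

theorem integral_sq_le_of_tail : ∫ ω, X ω ^ 2 ∂μ ≤ 20 := by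
  calc ∫ ω, X ω ^ 2 ∂μ ≤ ∫ ω, 4 * Real.exp (X ω ^ 2 / 4) ∂μ :=
        integral_mono (integrable_sq_of_tail hu hl hX) ((integrable_exp_sq hu hl hX).const_mul 4)
          fun ω => sq_le_exp_sq _
    _ ≤ 20 := by
        rw [integral_const_mul]
        have := integral_exp_sq_le hu hl hX
        linarith

/-- The expected excess of a sub-Gaussian variable over a level `b`. -/
theorem integral_max_abs_sub_le {σ b : ℝ} (hσ : 0 < σ) (hb : 0 < b) :
    Integrable (fun ω => max (|σ * X ω| - b) 0) μ ∧
    ∫ ω, max (|σ * X ω| - b) 0 ∂μ ≤ 10 * σ ^ 2 / b * Real.exp (-(b ^ 2 / (4 * σ ^ 2))) := by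
  -- For `u = |σ x| > b`, `u - b ≤ (u² - b²) / (2b)`; then `v ≤ exp v` is applied to `v = x²/4 -
  -- b²/(4σ²)`.
  have hpt : ∀ x : ℝ, max (|σ * x| - b) 0
      ≤ 2 * σ ^ 2 / b * Real.exp (-(b ^ 2 / (4 * σ ^ 2))) * Real.exp (x ^ 2 / 4) := by
    intro x
    rw [mul_assoc, ← Real.exp_add]
    refine max_le ?_ (by positivity)
    have h1 := Real.add_one_le_exp (-(b ^ 2 / (4 * σ ^ 2)) + x ^ 2 / 4)
    rcases le_or_gt (|σ * x|) b with h | h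
    · exact (sub_nonpos.2 h).trans (by positivity)
    · refine le_trans ?_ (mul_le_mul_of_nonneg_left
        ((le_add_of_nonneg_right zero_le_one).trans h1) (by positivity))
      have h2 : 2 * σ ^ 2 / b * (-(b ^ 2 / (4 * σ ^ 2)) + x ^ 2 / 4)
          = (|σ * x| ^ 2 - b ^ 2) / (2 * b) := by
        rw [sq_abs]; field_simp; ring
      rw [h2, le_div_iff₀ (by positivity)]
      nlinarith
  have hint : Integrable (fun ω => 2 * σ ^ 2 / b * Real.exp (-(b ^ 2 / (4 * σ ^ 2)))
      * Real.exp (X ω ^ 2 / 4)) μ := (integrable_exp_sq hu hl hX).const_mul _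
  have hint' : Integrable (fun ω => max (|σ * X ω| - b) 0) μ := by
    refine hint.mono' (Measurable.aestronglyMeasurable (by fun_prop)) (.of_forall fun ω => ?_)
    rw [Real.norm_of_nonneg (le_max_right _ _)]
    exact hpt _
  refine ⟨hint', (integral_mono hint' hint fun ω => hpt _).trans ?_⟩
  rw [integral_const_mul]
  have := mul_le_mul_of_nonneg_left (integral_exp_sq_le hu hl hX)
    (show 0 ≤ 2 * σ ^ 2 / b * Real.exp (-(b ^ 2 / (4 * σ ^ 2))) by positivity)
  refine this.trans (le_of_eq ?_)
  ring

end Tails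

/-! ### Consequences of non-anticipation -/

section History

variable {Ω K : Type*} {N : ℕ} {ρ : Ω → (Fin N ≃ K)} {y : Ω → K → ℝ}

theorem measurable_history_point {t t' : Fin N} (h : t' ≤ t) :
    Measurable[history ρ y t, ⊤] fun ω => ρ ω t' :=
  measurable_iff_comap_le.2 (le_sup_of_le_left (le_iSup₂_of_le t' h le_rfl))

theorem measurable_history_comp_point {t t' : Fin N} (h : t' ≤ t) {β : Type*} [MeasurableSpace β]
    (f : K → β) : Measurable[history ρ y t] fun ω => f (ρ ω t') :=
  (@measurable_from_top K β _ f).comp (measurable_history_point h)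

theorem measurableSet_history_point {t t' : Fin N} (h : t' ≤ t) (p : K → Prop) :
    MeasurableSet[history ρ y t] {ω | p (ρ ω t')} :=
  measurable_history_point h (show MeasurableSet[⊤] {s | p s} from trivial)

theorem measurable_history_obs {t t' : Fin N} (h : t' < t) :
    Measurable[history ρ y t] fun ω => y ω (ρ ω t') :=
  measurable_iff_comap_le.2 (le_sup_of_le_right (le_iSup₂_of_le t' h le_rfl))

theorem history_mono {t t' : Fin N} (h : t' ≤ t) : history ρ y t' ≤ history ρ y t := by
  refine sup_le (iSup₂_le fun t'' h'' => ?_) (iSup₂_le fun t'' h'' => ?_)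
  · exact measurable_iff_comap_le.1 (measurable_history_point (h''.trans h))
  · exact measurable_iff_comap_le.1 (measurable_history_obs (h''.trans_le h))

/-- The history records observations, not noise; `σ > 0` allows the noise at a revealed point to be
recovered from them. -/
theorem measurable_history_noise {ε : K → Ω → ℝ} {θ : K → ℝ} {σ : ℝ} (hσ : 0 < σ) {t t' : Fin N}
    (h : t' < t) : Measurable[history ρ (observation θ σ ε) t] fun ω => ε (ρ ω t') ω := by
  have h1 : (fun ω => ε (ρ ω t') ω)
      = fun ω => (observation θ σ ε ω (ρ ω t') - θ (ρ ω t')) / σ := by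
    funext ω
    unfold observation
    field_simp
    ring
  rw [h1]
  exact Measurable.div_const (Measurable.sub (measurable_history_obs h)
    (measurable_history_comp_point h.le θ)) σ

variable [Fintype K]

theorem eval_point_eq_sum [DecidableEq K] (f : K → Ω → ℝ) (t : Fin N) :
    (fun ω => f (ρ ω t) ω) = fun ω => ∑ s, ({ω | ρ ω t = s} : Set Ω).indicator (f s) ω := by
  funext ω
  simp [Set.indicator_apply]

variable [MeasurableSpace Ω]

theorem measurable_eval_point (hρ : ∀ t s, MeasurableSet {ω | ρ ω t = s}) {f : K → Ω → ℝ}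
    (hf : ∀ s, Measurable (f s)) (t : Fin N) : Measurable fun ω => f (ρ ω t) ω := by
  classical
  rw [eval_point_eq_sum]
  exact Finset.measurable_sum _ fun s _ => (hf s).indicator (hρ t s)

theorem integrable_eval_point {μ : Measure Ω} (hρ : ∀ t s, MeasurableSet {ω | ρ ω t = s})
    {f : K → Ω → ℝ} (hf : ∀ s, Integrable (f s) μ) (t : Fin N) :
    Integrable (fun ω => f (ρ ω t) ω) μ := by
  classical
  rw [eval_point_eq_sum]
  exact integrable_finsetSum _ fun s _ => (hf s).indicator (hρ t s)

theorem history_le (hρ : ∀ t s, MeasurableSet {ω | ρ ω t = s}) (hy : ∀ s, Measurable fun ω => y ω s)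
    (t : Fin N) : history ρ y t ≤ ‹MeasurableSpace Ω› := by
  refine sup_le (iSup₂_le fun t' h => ?_) (iSup₂_le fun t' h => ?_)
  · rintro A ⟨B, -, rfl⟩
    have : (fun ω => ρ ω t') ⁻¹' B = ⋃ s ∈ B, {ω | ρ ω t' = s} := by ext ω; simp
    rw [this]
    exact MeasurableSet.biUnion (Set.to_countable B) fun s _ => hρ t' s
  · exact measurable_iff_comap_le.1 (measurable_eval_point (f := fun s ω => y ω s) hρ hy t')

end History

section Noise

variable {Ω K : Type*} [MeasurableSpace Ω] {μ : Measure Ω} {ε : K → Ω → ℝ}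

theorem IsNoise.measurable_observation (hε : IsNoise μ ε) (θ : K → ℝ) (σ : ℝ) (s : K) :
    Measurable fun ω => observation θ σ ε ω s := by
  have := hε.measurable s
  unfold observation
  fun_prop

theorem IsNoise.integrable_sq [IsProbabilityMeasure μ] (hε : IsNoise μ ε) (s : K) :
    Integrable (fun ω => ε s ω ^ 2) μ :=
  integrable_sq_of_tail (hε.upper_tail s) (hε.lower_tail s) (hε.measurable s)

theorem IsNonAnticipating.history_le [Fintype K] {N : ℕ} {ρ : Ω → (Fin N ≃ K)} {θ : K → ℝ} {σ : ℝ}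
    (hε : IsNoise μ ε) (hρ : IsNonAnticipating μ ε (observation θ σ ε) ρ) (t : Fin N) :
    history ρ (observation θ σ ε) t ≤ ‹MeasurableSpace Ω› :=
  OnlineTV.history_le hρ.measurableSet_eq (hε.measurable_observation θ σ) t

end Noise

section NonAnticipating

variable {Ω K : Type*} [MeasurableSpace Ω] [Fintype K] {N : ℕ}
  {μ : Measure Ω} [IsProbabilityMeasure μ] {ε : K → Ω → ℝ} {θ : K → ℝ} {σ : ℝ}
  {ρ : Ω → (Fin N ≃ K)}

variable (hε : IsNoise μ ε) (hρ : IsNonAnticipating μ ε (observation θ σ ε) ρ)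

include hε hρ

/-- An event of the history on which `ρ t = s` is independent of `ε s`. -/
theorem IsNonAnticipating.measureReal_inter {t : Fin N} {s : K} {D : Set Ω}
    (hD : MeasurableSet[history ρ (observation θ σ ε) t] D) (hDs : ∀ ω ∈ D, ρ ω t = s)
    {B : Set ℝ} (hB : MeasurableSet B) :
    μ.real (D ∩ ε s ⁻¹' B) = μ.real D * μ.real (ε s ⁻¹' B) := by
  have hle := IsNonAnticipating.history_le hε hρ t
  have hB' : MeasurableSet {ω' | ε (ρ ω' t) ω' ∈ B} :=
    measurable_eval_point hρ.measurableSet_eq hε.measurable t hB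
  have h1 := setIntegral_condExp (μ := μ) hle
    (f := ({ω' | ε (ρ ω' t) ω' ∈ B} : Set Ω).indicator fun _ => (1 : ℝ))
    ((integrable_const 1).indicator hB') hD
  have h2 : ∫ ω in D, (μ⟦{ω' | ε (ρ ω' t) ω' ∈ B} | history ρ (observation θ σ ε) t⟧) ω ∂μ
      = ∫ ω in D, μ.real {ω' | ε s ω' ∈ B} ∂μ := by
    refine setIntegral_congr_ae (hle _ hD) ?_
    filter_upwards [hρ.cond_law t s B hB] with ω hω hωD
    exact hω (hDs ω hωD)
  rw [h2, setIntegral_const, smul_eq_mul, integral_indicator hB', setIntegral_const, smul_eq_mul,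
    mul_one, measureReal_restrict_apply hB'] at h1
  rw [show (ε s ⁻¹' B) = {ω' | ε s ω' ∈ B} from rfl, h1]
  congr 1
  ext ω
  simp only [Set.mem_inter_iff, Set.mem_ofPred_eq]
  constructor
  · rintro ⟨h, h'⟩; exact ⟨by rwa [hDs ω h], h⟩
  · rintro ⟨h', h⟩; exact ⟨h, by rwa [hDs ω h] at h'⟩

/-- By the independence just shown, the law of `ε s` restricted to `D` is `μ D` times its full law.
-/
theorem IsNonAnticipating.setIntegral_comp {t : Fin N} {s : K} {D : Set Ω}
    (hD : MeasurableSet[history ρ (observation θ σ ε) t] D) (hDs : ∀ ω ∈ D, ρ ω t = s)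
    {φ : ℝ → ℝ} (hφ : Measurable φ) :
    ∫ ω in D, φ (ε s ω) ∂μ = μ.real D * ∫ ω, φ (ε s ω) ∂μ := by
  have hm := hε.measurable s
  have hle := IsNonAnticipating.history_le hε hρ t
  have hmap : (μ.restrict D).map (ε s) = ENNReal.ofReal (μ.real D) • μ.map (ε s) := by
    ext B hB
    rw [Measure.map_apply hm hB, Measure.smul_apply, Measure.map_apply hm hB,
      Measure.restrict_apply (hm hB), Set.inter_comm, smul_eq_mul, ← ofReal_measureReal,
      IsNonAnticipating.measureReal_inter hε hρ hD hDs hB, ENNReal.ofReal_mul measureReal_nonneg,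
      ofReal_measureReal (s := ε s ⁻¹' B)]
  rw [← integral_map (φ := ε s) (f := φ) hm.aemeasurable hφ.aestronglyMeasurable, hmap,
    integral_smul_measure, integral_map hm.aemeasurable hφ.aestronglyMeasurable,
    ENNReal.toReal_ofReal measureReal_nonneg, smul_eq_mul]

theorem IsNonAnticipating.setIntegral_eval {t : Fin N} {D : Set Ω}
    (hD : MeasurableSet[history ρ (observation θ σ ε) t] D) {φ : ℝ → ℝ} (hφ : Measurable φ)
    (hint : ∀ s, Integrable (fun ω => φ (ε s ω)) μ) :
    ∫ ω in D, φ (ε (ρ ω t) ω) ∂μ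
      = ∑ s, μ.real (D ∩ {ω | ρ ω t = s}) * ∫ ω, φ (ε s ω) ∂μ := by
  classical
  have hle := IsNonAnticipating.history_le hε hρ t
  rw [eval_point_eq_sum (ρ := ρ) (fun s ω => φ (ε s ω)) t, integral_finsetSum]
  · refine Finset.sum_congr rfl fun s _ => ?_
    have hDs : MeasurableSet[history ρ (observation θ σ ε) t] (D ∩ {ω | ρ ω t = s}) :=
      MeasurableSet.inter hD (measurableSet_history_point le_rfl fun u => u = s)
    rw [← IsNonAnticipating.setIntegral_comp hε hρ hDs (fun ω h => h.2) hφ,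
      setIntegral_indicator (hρ.measurableSet_eq t s)]
  · intro s _
    exact ((hint s).indicator (hρ.measurableSet_eq t s)).integrableOn

/-- Over any event of the history, splitting by the value of `ρ t` leaves multiples of the means of
the `ε s`. Thus the revealed noise is a martingale difference sequence. -/
theorem IsNonAnticipating.condExp_eval (t : Fin N) :
    μ[fun ω => ε (ρ ω t) ω | history ρ (observation θ σ ε) t] =ᵐ[μ] 0 := by
  have hle := IsNonAnticipating.history_le hε hρ t
  symm
  refine ae_eq_condExp_of_forall_setIntegral_eq hle
    (integrable_eval_point hρ.measurableSet_eq hε.integrable t)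
    (fun s _ _ => integrableOn_zero) (fun D hD _ => ?_) aestronglyMeasurable_zero
  have := IsNonAnticipating.setIntegral_eval hε hρ hD (φ := fun x => x) measurable_id hε.integrable
  rw [this]
  simp [hε.mean_zero]

/-- A factor known before the observation of round `t` can be pulled out of the conditional
expectation. This gives both the orthogonality of increments and the vanishing of the cross term in
the regret. -/
theorem IsNonAnticipating.integral_mul_eval {t : Fin N} {G : Ω → ℝ}
    (hG : Measurable[history ρ (observation θ σ ε) t] G)
    (hint : Integrable (fun ω => G ω * ε (ρ ω t) ω) μ) :
    ∫ ω, G ω * ε (ρ ω t) ω ∂μ = 0 := by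
  have hle := IsNonAnticipating.history_le hε hρ t
  have h1 : μ[fun ω => G ω * ε (ρ ω t) ω | history ρ (observation θ σ ε) t]
      =ᵐ[μ] G * μ[fun ω => ε (ρ ω t) ω | history ρ (observation θ σ ε) t] :=
    condExp_mul_of_aestronglyMeasurable_left
      (Measurable.stronglyMeasurable hG).aestronglyMeasurable hint
      (integrable_eval_point hρ.measurableSet_eq hε.integrable t)
  rw [← integral_condExp hle]
  rw [integral_congr_ae (h1.trans ((Filter.EventuallyEq.refl _ G).mul
    (IsNonAnticipating.condExp_eval hε hρ t)))]
  simp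

theorem IsNonAnticipating.setIntegral_eval_sq_le {t : Fin N} {D : Set Ω}
    (hD : MeasurableSet[history ρ (observation θ σ ε) t] D) :
    ∫ ω in D, ε (ρ ω t) ω ^ 2 ∂μ ≤ 20 * μ.real D := by
  classical
  have hle := IsNonAnticipating.history_le hε hρ t
  rw [IsNonAnticipating.setIntegral_eval hε hρ hD (φ := fun x => x ^ 2) (by fun_prop)
    (IsNoise.integrable_sq hε)]
  have hsum : ∑ s, μ.real (D ∩ {ω | ρ ω t = s}) = μ.real D := by
    rw [← measureReal_biUnion_finset]
    · congr 1; ext ω; simp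
    · intro s _ s' _ hne
      refine Set.disjoint_left.2 fun ω h h' => hne (h.2.symm.trans h'.2)
    · intro s _
      exact (hle _ hD).inter (hρ.measurableSet_eq t s)
  rw [← hsum, Finset.mul_sum]
  refine Finset.sum_le_sum fun s _ => ?_
  rw [mul_comm]
  exact mul_le_mul_of_nonneg_right
    (integral_sq_le_of_tail (hε.upper_tail s) (hε.lower_tail s) (hε.measurable s))
    measureReal_nonneg

/-- Orthogonality of the martingale increments. -/
theorem IsNonAnticipating.integral_sum_indicator_sq_le (hσ : 0 < σ) {D : Fin N → Set Ω}
    (hD : ∀ t, MeasurableSet[history ρ (observation θ σ ε) t] (D t)) :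
    Integrable (fun ω => (∑ t, (D t).indicator (fun ω => ε (ρ ω t) ω) ω) ^ 2) μ ∧
    ∫ ω, (∑ t, (D t).indicator (fun ω => ε (ρ ω t) ω) ω) ^ 2 ∂μ ≤ 20 * ∑ t, μ.real (D t) := by
  classical
  set Y : Fin N → Ω → ℝ := fun t => (D t).indicator fun ω => ε (ρ ω t) ω with hY
  have hle := IsNonAnticipating.history_le hε hρ
  have hEm : ∀ t, Measurable fun ω => ε (ρ ω t) ω :=
    measurable_eval_point hρ.measurableSet_eq hε.measurable
  have hYm : ∀ t, Measurable (Y t) := fun t => (hEm t).indicator (hle t _ (hD t))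
  have hE2 : ∀ t, MemLp (fun ω => ε (ρ ω t) ω) 2 μ := fun t =>
    (memLp_two_iff_integrable_sq (hEm t).aestronglyMeasurable).2
      (integrable_eval_point (f := fun s ω => ε s ω ^ 2) hρ.measurableSet_eq
        (IsNoise.integrable_sq hε) t)
  have hY2 : ∀ t, MemLp (Y t) 2 μ := fun t => (hE2 t).indicator (hle t _ (hD t))
  have hint : ∀ t t', Integrable (fun ω => Y t ω * Y t' ω) μ := fun t t' =>
    (hY2 t).integrable_mul (hY2 t')
  have hsq : (fun ω => (∑ t, Y t ω) ^ 2) = fun ω => ∑ t, ∑ t', Y t ω * Y t' ω := by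
    funext ω; rw [sq, Finset.sum_mul_sum]
  -- The earlier increment, restricted to `D t`, is already part of the history at round `t`.
  have hoff : ∀ t t', t' < t → ∫ ω, Y t ω * Y t' ω ∂μ = 0 := by
    intro t t' h
    have heq : (fun ω => Y t ω * Y t' ω)
        = fun ω => (D t).indicator (Y t') ω * ε (ρ ω t) ω := by
      funext ω
      simp only [hY, Set.indicator_apply]
      split_ifs <;> ring
    have hG : Measurable[history ρ (observation θ σ ε) t] ((D t).indicator (Y t')) := by
      refine Measurable.indicator ?_ (hD t)
      exact Measurable.indicator (measurable_history_noise hσ h)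
        (history_mono h.le _ (hD t'))
    have hi := hint t t'
    rw [heq] at hi ⊢
    exact IsNonAnticipating.integral_mul_eval hε hρ hG hi
  change Integrable (fun ω => (∑ t, Y t ω) ^ 2) μ ∧ ∫ ω, (∑ t, Y t ω) ^ 2 ∂μ ≤ _
  rw [hsq]
  refine ⟨integrable_finsetSum _ fun t _ => integrable_finsetSum _ fun t' _ => hint t t', ?_⟩
  rw [integral_finsetSum _ fun t _ => integrable_finsetSum _ fun t' _ => hint t t',
    Finset.mul_sum]
  refine Finset.sum_le_sum fun t _ => ?_
  rw [integral_finsetSum _ fun t' _ => hint t t', Finset.sum_eq_single t]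
  · refine le_trans (le_of_eq ?_) (IsNonAnticipating.setIntegral_eval_sq_le hε hρ (hD t))
    rw [← integral_indicator (hle t _ (hD t))]
    congr 1
    funext ω
    simp only [hY, Set.indicator_apply]
    split_ifs <;> ring
  · intro t' _ hne
    rcases lt_or_gt_of_ne hne with h | h
    · exact hoff t t' h
    · simp_rw [mul_comm (Y t _)]
      exact hoff t' t h
  · simp

end NonAnticipating

/-! ### Measurability of the algorithm -/

section Measurability

variable {Ω K : Type*} [DecidableEq K] {N : ℕ} {ρ : Ω → (Fin N ≃ K)} {y : Ω → K → ℝ}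

theorem sum_revealed_inter (τ : Fin N ≃ K) (S : Finset K) (t : Fin N) (f : K → ℝ) :
    ∑ u ∈ revealed τ t ∩ S, f u = ∑ t' ∈ Finset.Iio t, if τ t' ∈ S then f (τ t') else 0 := by
  rw [Finset.inter_comm, ← Finset.filter_mem_eq_inter, ← Finset.sum_filter]
  symm
  refine Finset.sum_bij (fun t' _ => τ t') ?_ (by simp) ?_ (by simp)
  · intro t' h
    simp only [Finset.mem_filter, Finset.mem_Iio] at h
    simp [revealed, h]
  · intro s hs
    simp only [revealed, Finset.mem_filter, Finset.mem_map, Finset.mem_Iio,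
      Equiv.coe_toEmbedding] at hs
    obtain ⟨hS, t', h, rfl⟩ := hs
    exact ⟨t', by simp [h, hS], rfl⟩

theorem measurable_history_card (S : Finset K) (t : Fin N) :
    Measurable[history ρ y t] fun ω => ((revealed (ρ ω) t ∩ S).card : ℝ) := by
  have : (fun ω => ((revealed (ρ ω) t ∩ S).card : ℝ))
      = fun ω => ∑ t' ∈ Finset.Iio t, if ρ ω t' ∈ S then (1 : ℝ) else 0 := by
    funext ω
    rw [← sum_revealed_inter (ρ ω) S t fun _ => 1]
    simp
  rw [this]
  refine Finset.measurable_sum _ fun t' ht' => ?_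
  exact measurable_history_comp_point (Finset.mem_Iio.1 ht').le fun s => if s ∈ S then (1 : ℝ) else 0

theorem measurable_history_mean (S : Finset K) (t : Fin N) :
    Measurable[history ρ y t] fun ω => mean (revealed (ρ ω) t ∩ S) (y ω) := by
  unfold mean
  refine Measurable.div ?_ (measurable_history_card S t)
  simp_rw [sum_revealed_inter]
  refine Finset.measurable_sum _ fun t' ht' => ?_
  exact Measurable.ite (measurableSet_history_point (Finset.mem_Iio.1 ht').le fun s => s ∈ S)
    (measurable_history_obs (Finset.mem_Iio.1 ht')) measurable_const

theorem measurableSet_history_active (𝒮 : Finset (Finset K)) (S : Finset K) (t : Fin N) :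
    MeasurableSet[history ρ y t] {ω | S ∈ active 𝒮 (ρ ω) t} := by
  have : {ω | S ∈ active 𝒮 (ρ ω) t} = {ω | ρ ω t ∈ S} ∩
      ({ω | S ∈ 𝒮 ∧ (t : ℕ) = 0} ∪ ⋃ t' ∈ Set.Iio t, {ω | S ∈ 𝒮 ∧ ρ ω t' ∈ S}) := by
    ext ω
    simp only [active, Finset.mem_filter, Set.mem_ofPred_eq, Set.mem_inter_iff, Set.mem_union,
      Set.mem_iUnion, Set.mem_Iio, exists_prop]
    constructor
    · rintro ⟨h1, h2, h3 | ⟨t', h3, h4⟩⟩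
      · exact ⟨h2, Or.inl ⟨h1, h3⟩⟩
      · exact ⟨h2, Or.inr ⟨t', h3, h1, h4⟩⟩
    · rintro ⟨h2, ⟨h1, h3⟩ | ⟨t', h3, h1, h4⟩⟩
      · exact ⟨h1, h2, Or.inl h3⟩
      · exact ⟨h1, h2, Or.inr ⟨t', h3, h4⟩⟩
  rw [this]
  refine MeasurableSet.inter (measurableSet_history_point le_rfl fun s => s ∈ S)
    (MeasurableSet.union (MeasurableSet.const _)
      (MeasurableSet.biUnion (Set.to_countable _) fun t' ht' => ?_))
  exact measurableSet_history_point (le_of_lt ht') fun s => S ∈ 𝒮 ∧ s ∈ S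

theorem measurable_history_sum_active (𝒮 : Finset (Finset K)) {t t' : Fin N} (h : t' ≤ t)
    {f : Finset K → Ω → ℝ} (hf : ∀ S, Measurable[history ρ y t] (f S)) :
    Measurable[history ρ y t] fun ω => ∑ S ∈ active 𝒮 (ρ ω) t', f S ω := by
  have : (fun ω => ∑ S ∈ active 𝒮 (ρ ω) t', f S ω)
      = fun ω => ∑ S ∈ 𝒮, if S ∈ active 𝒮 (ρ ω) t' then f S ω else 0 := by
    funext ω
    rw [← Finset.sum_filter]
    congr 1
    ext S
    simp only [Finset.mem_filter]
    exact ⟨fun h => ⟨active_subset _ _ h, h⟩, fun h => h.2⟩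
  rw [this]
  refine Finset.measurable_sum _ fun S _ => ?_
  exact Measurable.ite (history_mono h _ (measurableSet_history_active 𝒮 S t')) (hf S)
    measurable_const

theorem measurable_history_expertLoss (lam : ℝ) (S : Finset K) {t t' : Fin N} (h : t' < t) :
    Measurable[history ρ y t] fun ω => expertLoss (meanRule K) lam (ρ ω) (y ω) S t' := by
  simp only [expertLoss, expertPred_meanRule]
  refine Measurable.pow_const (Measurable.sub ?_ ?_) 2
  · exact (measurable_trunc lam).comp (measurable_history_obs h)
  · exact (measurable_trunc lam).comp
      ((measurable_history_mean S t').mono (history_mono h.le) le_rfl)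

/-- The weights at the start of round `j` involve losses of rounds before `j` only, so `j = t` is
still allowed. -/
theorem measurable_history_weight (𝒮 : Finset (Finset K)) (lam : ℝ) {t : Fin N} {j : ℕ}
    (hj : j ≤ t) (S : Finset K) :
    Measurable[history ρ y t] fun ω => weight (meanRule K) 𝒮 lam (ρ ω) (y ω) j S := by
  induction j generalizing S with
  | zero => exact measurable_const
  | succ j ih =>
    have ih := ih (by omega)
    set t' : Fin N := ⟨j, by omega⟩ with ht'
    have hlt : t' < t := by rw [Fin.lt_def]; exact hj
    have hexp : ∀ S, Measurable[history ρ y t] fun ω =>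
        Real.exp (-(1 / (8 * lam ^ 2)) * expertLoss (meanRule K) lam (ρ ω) (y ω) S t') := fun S =>
      Real.measurable_exp.comp ((measurable_history_expertLoss lam S hlt).const_mul _)
    have hsucc := fun ω => weight_succ (meanRule K) (𝒮 := 𝒮) (lam := lam) (ρ ω) (y ω) t' S
    rw [show (t' : ℕ) = j from rfl] at hsucc
    simp_rw [hsucc]
    refine Measurable.ite (history_mono hlt.le _ (measurableSet_history_active 𝒮 S t')) ?_ (ih S)
    refine Measurable.div (Measurable.mul (ih S) (hexp S)) ?_
    refine measurable_history_sum_active 𝒮 hlt.le fun S' => Measurable.mul ?_ (hexp S')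
    exact Measurable.div (ih S') (measurable_history_sum_active 𝒮 hlt.le ih)

/-- The prediction uses the location `ρ t` but not the observation there; this predictability is
what the martingale argument requires. -/
theorem measurable_history_aggregate (𝒮 : Finset (Finset K)) (lam : ℝ) (t : Fin N) :
    Measurable[history ρ y t] fun ω => aggregate (meanRule K) 𝒮 lam (ρ ω) (y ω) (ρ ω t) := by
  simp_rw [aggregate_apply, expertPred_meanRule]
  refine measurable_history_sum_active 𝒮 le_rfl fun S => Measurable.mul ?_ ?_
  · exact Measurable.div (measurable_history_weight 𝒮 lam le_rfl S)
      (measurable_history_sum_active 𝒮 le_rfl fun S => measurable_history_weight 𝒮 lam le_rfl S)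
  · exact (measurable_trunc lam).comp (measurable_history_mean S t)

theorem measurable_aggregate [Fintype K] [MeasurableSpace Ω]
    (hρ : ∀ t s, MeasurableSet {ω | ρ ω t = s})
    (hy : ∀ s, Measurable fun ω => y ω s) (𝒮 : Finset (Finset K)) (lam : ℝ) (s : K) :
    Measurable fun ω => aggregate (meanRule K) 𝒮 lam (ρ ω) (y ω) s := by
  have : (fun ω => aggregate (meanRule K) 𝒮 lam (ρ ω) (y ω) s) = fun ω => ∑ t : Fin N,
      ({ω | ρ ω t = s} : Set Ω).indicator
        (fun ω => aggregate (meanRule K) 𝒮 lam (ρ ω) (y ω) (ρ ω t)) ω := by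
    funext ω
    rw [Finset.sum_eq_single ((ρ ω).symm s)]
    · simp
    · intro t _ ht
      rw [Set.indicator_of_notMem]
      intro h
      exact ht (by rw [← (show ρ ω t = s from h), Equiv.symm_apply_apply])
    · simp
  rw [this]
  exact Finset.measurable_sum _ fun t _ =>
    ((measurable_history_aggregate 𝒮 lam t).mono (history_le hρ hy t) le_rfl).indicator (hρ t s)

end Measurability

/-! ### Running means of the noise -/

section RunningMean

variable {K : Type*} [DecidableEq K] {N : ℕ}

theorem revealed_inter_mono (τ : Fin N ≃ K) (S : Finset K) {t t' : Fin N} (h : t' ≤ t) :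
    revealed τ t' ∩ S ⊆ revealed τ t ∩ S := by
  intro u
  simp only [mem_revealed_inter]
  exact fun hu => ⟨hu.1.trans_le h, hu.2⟩

theorem card_revealed_inter_lt_iff (τ : Fin N ≃ K) {S : Finset K} {t t' : Fin N} (ht' : τ t' ∈ S) :
    (revealed τ t' ∩ S).card < (revealed τ t ∩ S).card ↔ t' < t := by
  constructor
  · intro h
    by_contra hle
    exact absurd (Finset.card_le_card (revealed_inter_mono τ S (not_lt.1 hle))) (not_le.2 h)
  · intro h
    refine Finset.card_lt_card ((Finset.ssubset_iff_of_subset (revealed_inter_mono τ S h.le)).2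
      ⟨τ t', ?_, ?_⟩)
    · rw [mem_revealed_inter]; simpa using ⟨h, ht'⟩
    · rw [mem_revealed_inter]; simp

/-- The count of revealed points of `S` goes up strictly at each arrival in `S`, so arrivals may be
indexed by this count instead of by time. -/
theorem injOn_card_revealed_inter (τ : Fin N ≃ K) (S : Finset K) :
    Set.InjOn (fun t => (revealed τ t ∩ S).card) {t | τ t ∈ S} := by
  intro t ht t' ht' h
  by_contra hne
  rcases lt_or_gt_of_ne hne with hlt | hlt
  · exact absurd h ((card_revealed_inter_lt_iff τ ht).2 hlt).ne
  · exact absurd h ((card_revealed_inter_lt_iff τ ht').2 hlt).ne'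

/-- The sum of the squared running means of `x` over `S` is at most the sum of the squares of
the means of the first `j` revealed values. -/
theorem sum_running_mean_sq_le (τ : Fin N ≃ K) (S : Finset K) (x : K → ℝ) :
    ∑ t : Fin N, (if τ t ∈ S ∧ (revealed τ t ∩ S).Nonempty then
        mean (revealed τ t ∩ S) x ^ 2 else 0)
      ≤ ∑ j ∈ Finset.Icc 1 N, (∑ t : Fin N,
          if τ t ∈ S ∧ (revealed τ t ∩ S).card < j then x (τ t) else 0) ^ 2 / (j : ℝ) ^ 2 := by
  set g : ℕ → ℝ := fun j => (∑ t : Fin N,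
          if τ t ∈ S ∧ (revealed τ t ∩ S).card < j then x (τ t) else 0) ^ 2 / (j : ℝ) ^ 2 with hg
  -- The points of `S` revealed before `t` are the arrivals at which the count was below its value
  -- `j` at `t`. Each running mean thus becomes a function of the deterministic index `j`.
  have hmean : ∀ t, mean (revealed τ t ∩ S) x ^ 2 = g (revealed τ t ∩ S).card := by
    intro t
    rw [hg, mean, div_pow, sum_revealed_inter]
    congr 2
    rw [← Finset.sum_filter, ← Finset.sum_filter]
    refine Finset.sum_congr ?_ fun _ _ => rfl
    ext t'
    simp only [Finset.mem_filter, Finset.mem_Iio, Finset.mem_univ, true_and]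
    constructor
    · rintro ⟨h, hS⟩; exact ⟨hS, (card_revealed_inter_lt_iff τ hS).2 h⟩
    · rintro ⟨hS, h⟩; exact ⟨(card_revealed_inter_lt_iff τ hS).1 h, hS⟩
  simp_rw [hmean]
  rw [← Finset.sum_filter]
  rw [← Finset.sum_image (f := g) (g := fun t => (revealed τ t ∩ S).card)]
  · refine Finset.sum_le_sum_of_subset_of_nonneg ?_ fun _ _ _ => by positivity
    intro j hj
    simp only [Finset.mem_image, Finset.mem_filter, Finset.mem_univ, true_and] at hj
    obtain ⟨t, ⟨-, hne⟩, rfl⟩ := hj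
    rw [Finset.mem_Icc]
    refine ⟨hne.card_pos, (Finset.card_le_card Finset.inter_subset_left).trans ?_⟩
    simp only [revealed, Finset.card_map, Fin.card_Iio]
    exact t.2.le
  · intro t ht t' ht' h
    simp only [Finset.coe_filter, Finset.mem_univ, true_and, Set.mem_ofPred_eq] at ht ht'
    exact injOn_card_revealed_inter τ S ht.1 ht'.1 h

theorem sum_card_lt_le (τ : Fin N ≃ K) (S : Finset K) (j : ℕ) :
    ∑ t : Fin N, (if τ t ∈ S ∧ (revealed τ t ∩ S).card < j then (1 : ℝ) else 0) ≤ j := by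
  rw [← Finset.sum_filter, Finset.sum_const, nsmul_eq_mul, mul_one]
  have := Finset.card_le_card_of_injOn (s := Finset.univ.filter fun t : Fin N =>
    τ t ∈ S ∧ (revealed τ t ∩ S).card < j) (t := Finset.range j)
    (fun t => (revealed τ t ∩ S).card) ?_ ?_
  · rw [Finset.card_range] at this
    exact_mod_cast this
  · intro t ht
    simp only [Finset.coe_filter, Finset.mem_univ, true_and, Set.mem_ofPred_eq] at ht
    simpa using ht.2
  · intro t ht t' ht' h
    simp only [Finset.coe_filter, Finset.mem_univ, true_and, Set.mem_ofPred_eq] at ht ht'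
    exact injOn_card_revealed_inter τ S ht.1 ht'.1 h

variable {Ω : Type*} [MeasurableSpace Ω] [Fintype K]
  {μ : Measure Ω} [IsProbabilityMeasure μ] {ε : K → Ω → ℝ} {θ : K → ℝ} {σ : ℝ}
  {ρ : Ω → (Fin N ≃ K)}

/-- Being among the first `j` arrivals in `S` is an event of the history, and at most `j` rounds
satisfy it; orthogonality of the increments does the rest. -/
theorem IsNonAnticipating.integral_first_sum_sq_le (hε : IsNoise μ ε)
    (hρ : IsNonAnticipating μ ε (observation θ σ ε) ρ) (hσ : 0 < σ) (S : Finset K) (j : ℕ) :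
    Integrable (fun ω => (∑ t : Fin N, if ρ ω t ∈ S ∧ (revealed (ρ ω) t ∩ S).card < j
        then ε (ρ ω t) ω else 0) ^ 2) μ ∧
    ∫ ω, (∑ t : Fin N, if ρ ω t ∈ S ∧ (revealed (ρ ω) t ∩ S).card < j
        then ε (ρ ω t) ω else 0) ^ 2 ∂μ ≤ 20 * j := by
  classical
  set D : Fin N → Set Ω := fun t => {ω | ρ ω t ∈ S ∧ (revealed (ρ ω) t ∩ S).card < j} with hDdef
  have hD : ∀ t, MeasurableSet[history ρ (observation θ σ ε) t] (D t) := by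
    intro t
    have hinter : D t = {ω | ρ ω t ∈ S} ∩ {ω | (revealed (ρ ω) t ∩ S).card < j} := rfl
    rw [hinter]
    refine MeasurableSet.inter (measurableSet_history_point le_rfl fun s => s ∈ S) ?_
    have := measurable_history_card (ρ := ρ) (y := observation θ σ ε) S t
      (measurableSet_Iio (a := (j : ℝ)))
    have heq : (fun ω => ((revealed (ρ ω) t ∩ S).card : ℝ)) ⁻¹' Set.Iio (j : ℝ)
        = {ω | (revealed (ρ ω) t ∩ S).card < j} := by ext ω; simp
    rwa [heq] at this
  have hle := IsNonAnticipating.history_le hε hρ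
  have key := IsNonAnticipating.integral_sum_indicator_sq_le hε hρ hσ hD
  have heq : ∀ t ω, (D t).indicator (fun ω => ε (ρ ω t) ω) ω
      = if ρ ω t ∈ S ∧ (revealed (ρ ω) t ∩ S).card < j then ε (ρ ω t) ω else 0 := by
    intro t ω
    simp only [hDdef, Set.indicator_apply, Set.mem_ofPred_eq]
  simp_rw [heq] at key
  refine ⟨key.1, key.2.trans ?_⟩
  have hsum : ∑ t, μ.real (D t) = ∫ ω, ∑ t, (D t).indicator (fun _ => (1 : ℝ)) ω ∂μ := by
    rw [integral_finsetSum _ fun t _ => (integrable_const 1).indicator (hle t _ (hD t))]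
    refine Finset.sum_congr rfl fun t _ => ?_
    rw [integral_indicator_const _ (hle t _ (hD t)), smul_eq_mul, mul_one]
  have : ∑ t, μ.real (D t) ≤ j := by
    rw [hsum]
    calc _ ≤ ∫ _, (j : ℝ) ∂μ := by
          refine integral_mono (integrable_finsetSum _ fun t _ =>
            (integrable_const 1).indicator (hle t _ (hD t))) (integrable_const _) fun ω => ?_
          refine le_trans (le_of_eq ?_) (sum_card_lt_le (ρ ω) S j)
          simp only [hDdef, Set.indicator_apply, Set.mem_ofPred_eq]
      _ = j := by simp
  linarith

/-- The squared running means of the noise over a set add up to at most a logarithm. -/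
theorem IsNonAnticipating.integral_sum_running_mean_sq_le (hε : IsNoise μ ε)
    (hρ : IsNonAnticipating μ ε (observation θ σ ε) ρ) (hσ : 0 < σ) (S : Finset K) :
    ∃ g : Ω → ℝ, Integrable g μ ∧ (∀ ω, ∑ t : Fin N,
      (if ρ ω t ∈ S ∧ (revealed (ρ ω) t ∩ S).Nonempty then
        mean (revealed (ρ ω) t ∩ S) (fun s => ε s ω) ^ 2 else 0) ≤ g ω) ∧
      ∫ ω, g ω ∂μ ≤ 20 * (1 + Real.log N) := by
  have h1 := IsNonAnticipating.integral_first_sum_sq_le hε hρ hσ S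
  refine ⟨_, integrable_finsetSum _ fun j _ => ((h1 j).1.div_const ((j : ℝ) ^ 2)),
    fun ω => sum_running_mean_sq_le (ρ ω) S fun s => ε s ω, ?_⟩
  rw [integral_finsetSum _ fun j _ => ((h1 j).1.div_const ((j : ℝ) ^ 2))]
  -- The second moment `20 j` divided by `j²` leaves a harmonic sum.
  calc _ ≤ ∑ j ∈ Finset.Icc 1 N, 20 * ((j : ℝ))⁻¹ := by
        refine Finset.sum_le_sum fun j hj => ?_
        have hj0 : (0 : ℝ) < j := by exact_mod_cast (Finset.mem_Icc.1 hj).1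
        rw [integral_div, div_le_iff₀ (by positivity)]
        refine (h1 j).2.trans (le_of_eq ?_)
        field_simp
    _ ≤ 20 * (1 + Real.log N) := by
        rw [← Finset.mul_sum]
        have := harmonic_le_one_add_log N
        rw [harmonic_eq_sum_Icc] at this
        push_cast at this
        linarith

end RunningMean

/-! ### The expected error on one expert -/

section Oracle

theorem integrable_and_integral_affine {Ω : Type*} [MeasurableSpace Ω] {μ : Measure Ω}
    [IsProbabilityMeasure μ] {f g h : Ω → ℝ} (hf : Integrable f μ) (hg : Integrable g μ)
    (hh : Integrable h μ) (a b c d : ℝ) :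
    Integrable (fun ω => a + b * f ω + c * g ω + d * h ω) μ ∧
    ∫ ω, a + b * f ω + c * g ω + d * h ω ∂μ
      = a + b * ∫ ω, f ω ∂μ + c * ∫ ω, g ω ∂μ + d * ∫ ω, h ω ∂μ := by
  have h1 : Integrable (fun ω => a + b * f ω) μ := (integrable_const a).add (hf.const_mul b)
  have h2 : Integrable (fun ω => a + b * f ω + c * g ω) μ := h1.add (hg.const_mul c)
  refine ⟨h2.add (hh.const_mul d), ?_⟩
  rw [integral_add h2 (hh.const_mul d), integral_add h1 (hg.const_mul c),
    integral_add (integrable_const a) (hf.const_mul b)]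
  simp [integral_const_mul]

/-- Since `|θ| ≤ λ/2`, only noise above the level `b = λ/2` is truncated. -/
theorem integral_abs_sub_trunc_le {Ω K : Type*} [MeasurableSpace Ω] {μ : Measure Ω}
    [IsProbabilityMeasure μ] {ε : K → Ω → ℝ} {θ : K → ℝ} {σ lam : ℝ} (hε : IsNoise μ ε)
    (hσ : 0 < σ) (hlam : 0 < lam)
    (hθ : ∀ s, |θ s| ≤ lam / 2) (s : K) :
    Integrable (fun ω => |observation θ σ ε ω s - trunc lam (observation θ σ ε ω s)|) μ ∧
    ∫ ω, |observation θ σ ε ω s - trunc lam (observation θ σ ε ω s)| ∂μ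
      ≤ 20 * σ ^ 2 / lam * Real.exp (-(lam ^ 2 / (16 * σ ^ 2))) := by
  obtain ⟨h1, h2⟩ := integral_max_abs_sub_le (hε.upper_tail s) (hε.lower_tail s) (hε.measurable s) hσ
    (half_pos hlam)
  have hpt : ∀ ω, |observation θ σ ε ω s - trunc lam (observation θ σ ε ω s)|
      ≤ max (|σ * ε s ω| - lam / 2) 0 := by
    intro ω
    have := hθ s
    refine (abs_sub_trunc_le (c := θ s) (by linarith)).trans (max_le_max ?_ le_rfl)
    have : observation θ σ ε ω s - θ s = σ * ε s ω := by unfold observation; ring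
    rw [this]
    linarith
  have hm := hε.measurable_observation θ σ s
  have hint : Integrable
      (fun ω => |observation θ σ ε ω s - trunc lam (observation θ σ ε ω s)|) μ := by
    refine h1.mono' ?_ (.of_forall fun ω => ?_)
    · exact (continuous_abs.measurable.comp
        (hm.sub ((measurable_trunc lam).comp hm))).aestronglyMeasurable
    · rw [Real.norm_of_nonneg (abs_nonneg _)]; exact hpt ω
  refine ⟨hint, (integral_mono hint h1 hpt).trans (h2.trans (le_of_eq ?_))⟩
  congr 1
  · field_simp; norm_num
  · congr 2; field_simp; norm_num

variable {Ω K : Type*} [MeasurableSpace Ω] [Fintype K] [DecidableEq K] {N : ℕ}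
  {μ : Measure Ω} [IsProbabilityMeasure μ] {ε : K → Ω → ℝ} {θ : K → ℝ} {σ lam : ℝ}
  {ρ : Ω → (Fin N ≃ K)} {𝒮 : Finset (Finset K)} {S : Finset K}

theorem integrable_aggregate_sub_sq (hε : IsNoise μ ε)
    (hρ : IsNonAnticipating μ ε (observation θ σ ε) ρ) (h𝒮 : 𝒮.Nonempty) (hlam : 0 ≤ lam) (s : K) :
    Integrable (fun ω =>
      (aggregate (meanRule K) 𝒮 lam (ρ ω) (observation θ σ ε ω) s - θ s) ^ 2) μ := by
  have hm := measurable_aggregate hρ.measurableSet_eq (hε.measurable_observation θ σ) 𝒮 lam s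
  refine Integrable.of_bound (C := (lam + |θ s|) ^ 2)
    ((hm.sub_const _).pow_const 2).aestronglyMeasurable (.of_forall fun ω => ?_)
  rw [Real.norm_of_nonneg (sq_nonneg _), ← sq_abs]
  have := abs_aggregate_le (meanRule K) (lam := lam) (ρ ω) (observation θ σ ε ω) h𝒮 hlam s
  have h2 := abs_sub (aggregate (meanRule K) 𝒮 lam (ρ ω) (observation θ σ ε ω) s) (θ s)
  gcongr
  linarith

/-- The gap between the aggregate and the expert is known before the observation and bounded by `2
λ`, and it multiplies noise of conditional mean zero. -/
theorem integral_martingale_eq_zero (hε : IsNoise μ ε)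
    (hρ : IsNonAnticipating μ ε (observation θ σ ε) ρ) (h𝒮 : 𝒮.Nonempty) (hlam : 0 ≤ lam) :
    Integrable (fun ω => ∑ t : Fin N, (if S ∈ active 𝒮 (ρ ω) t then
      aggregate (meanRule K) 𝒮 lam (ρ ω) (observation θ σ ε ω) (ρ ω t)
        - trunc lam (mean (revealed (ρ ω) t ∩ S) (observation θ σ ε ω)) else 0)
          * (σ * ε (ρ ω t) ω)) μ ∧
    ∫ ω, ∑ t : Fin N, (if S ∈ active 𝒮 (ρ ω) t then
      aggregate (meanRule K) 𝒮 lam (ρ ω) (observation θ σ ε ω) (ρ ω t)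
        - trunc lam (mean (revealed (ρ ω) t ∩ S) (observation θ σ ε ω)) else 0)
          * (σ * ε (ρ ω t) ω) ∂μ = 0 := by
  set G : Fin N → Ω → ℝ := fun t ω => if S ∈ active 𝒮 (ρ ω) t then
      aggregate (meanRule K) 𝒮 lam (ρ ω) (observation θ σ ε ω) (ρ ω t)
        - trunc lam (mean (revealed (ρ ω) t ∩ S) (observation θ σ ε ω)) else 0 with hG
  have hGm : ∀ t, Measurable[history ρ (observation θ σ ε) t] (G t) := fun t =>
    Measurable.ite (measurableSet_history_active 𝒮 S t)
      (Measurable.sub (measurable_history_aggregate 𝒮 lam t)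
        ((measurable_trunc lam).comp (measurable_history_mean S t))) measurable_const
  have hGb : ∀ t ω, |G t ω| ≤ 2 * lam := by
    intro t ω
    simp only [hG]
    split_ifs
    · refine (abs_sub _ _).trans ?_
      have h1 := abs_aggregate_le (meanRule K) (lam := lam) (ρ ω) (observation θ σ ε ω) h𝒮 hlam (ρ ω t)
      have h2 := abs_trunc_le hlam (mean (revealed (ρ ω) t ∩ S) (observation θ σ ε ω))
      linarith
    · simpa using hlam
  have hint : ∀ t, Integrable (fun ω => G t ω * ε (ρ ω t) ω) μ := fun t =>
    (integrable_eval_point hρ.measurableSet_eq hε.integrable t).bdd_mul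
      ((hGm t).mono (IsNonAnticipating.history_le hε hρ t) le_rfl).aestronglyMeasurable
      (.of_forall fun ω => hGb t ω)
  have hrw : ∀ t ω, G t ω * (σ * ε (ρ ω t) ω) = σ * (G t ω * ε (ρ ω t) ω) := fun t ω => by ring
  change Integrable (fun ω => ∑ t, G t ω * (σ * ε (ρ ω t) ω)) μ ∧
    ∫ ω, ∑ t, G t ω * (σ * ε (ρ ω t) ω) ∂μ = 0
  simp_rw [hrw]
  refine ⟨integrable_finsetSum _ fun t _ => (hint t).const_mul σ, ?_⟩
  rw [integral_finsetSum _ fun t _ => (hint t).const_mul σ]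
  refine Finset.sum_eq_zero fun t _ => ?_
  rw [integral_const_mul, IsNonAnticipating.integral_mul_eval hε hρ (hGm t) (hint t), mul_zero]

theorem integral_sum_aggregate_sub_sq_le_aux (hε : IsNoise μ ε)
    (hρ : IsNonAnticipating μ ε (observation θ σ ε) ρ) (hσ : 0 < σ) (hlam : 0 < lam)
    (hθ : ∀ s, |θ s| ≤ lam / 2) (hS : S ∈ 𝒮) :
    ∫ ω, ∑ s ∈ S, (aggregate (meanRule K) 𝒮 lam (ρ ω) (observation θ σ ε ω) s - θ s) ^ 2 ∂μ
      ≤ 8 * lam ^ 2 * Real.log (𝒮.card : ℝ) + 4 * lam ^ 2 + 4 * sse S θ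
        + 40 * σ ^ 2 * (1 + Real.log N)
        + 80 * σ ^ 2 * (S.card * Real.exp (-(lam ^ 2 / (16 * σ ^ 2)))) := by
  have h𝒮 : 𝒮.Nonempty := ⟨S, hS⟩
  obtain ⟨g, hgi, hg, hgle⟩ := IsNonAnticipating.integral_sum_running_mean_sq_le hε hρ hσ S
  have htr := integral_abs_sub_trunc_le hε hσ hlam hθ
  obtain ⟨hMi, hM0⟩ := integral_martingale_eq_zero (S := S) hε hρ h𝒮 hlam.le
  have htri := integrable_finsetSum S fun s _ => (htr s).1
  have hpt : ∀ ω, ∑ s ∈ S,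
      (aggregate (meanRule K) 𝒮 lam (ρ ω) (observation θ σ ε ω) s - θ s) ^ 2
      ≤ (8 * lam ^ 2 * Real.log (𝒮.card : ℝ) + 4 * lam ^ 2 + 4 * sse S θ)
        + 2 * σ ^ 2 * g ω
        + 4 * lam * ∑ s ∈ S, |observation θ σ ε ω s - trunc lam (observation θ σ ε ω s)|
        + 2 * ∑ t : Fin N, (if S ∈ active 𝒮 (ρ ω) t then
            aggregate (meanRule K) 𝒮 lam (ρ ω) (observation θ σ ε ω) (ρ ω t)
              - trunc lam (mean (revealed (ρ ω) t ∩ S) (observation θ σ ε ω)) else 0)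
              * (σ * ε (ρ ω t) ω) := by
    intro ω
    refine (sum_aggregate_sub_sq_le (ρ ω) hlam hS (y := observation θ σ ε ω) (θ := θ)
      (η := fun s => σ * ε s ω) (fun s => rfl) fun s => (hθ s).trans (by linarith)).trans ?_
    have h1 : ∑ t : Fin N, (if ρ ω t ∈ S ∧ (revealed (ρ ω) t ∩ S).Nonempty then
        mean (revealed (ρ ω) t ∩ S) (fun s => σ * ε s ω) ^ 2 else 0)
        = σ ^ 2 * ∑ t : Fin N, (if ρ ω t ∈ S ∧ (revealed (ρ ω) t ∩ S).Nonempty then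
        mean (revealed (ρ ω) t ∩ S) (fun s => ε s ω) ^ 2 else 0) := by
      rw [Finset.mul_sum]
      refine Finset.sum_congr rfl fun t _ => ?_
      rw [mean_const_mul, mul_pow, mul_ite, mul_zero]
    rw [h1]
    have := mul_le_mul_of_nonneg_left (hg ω) (sq_nonneg σ)
    linarith
  obtain ⟨hint, hval⟩ := integrable_and_integral_affine hgi htri hMi
    (8 * lam ^ 2 * Real.log (𝒮.card : ℝ) + 4 * lam ^ 2 + 4 * sse S θ) (2 * σ ^ 2) (4 * lam) 2
  refine (integral_mono (integrable_finsetSum _ fun s _ =>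
    integrable_aggregate_sub_sq hε hρ h𝒮 hlam.le s) hint hpt).trans ?_
  rw [hval, hM0, integral_finsetSum _ fun s _ => (htr s).1]
  have h2 : 4 * lam * ∑ s ∈ S,
      ∫ ω, |observation θ σ ε ω s - trunc lam (observation θ σ ε ω s)| ∂μ
      ≤ 4 * lam * ∑ s ∈ S, 20 * σ ^ 2 / lam * Real.exp (-(lam ^ 2 / (16 * σ ^ 2))) := by
    gcongr with s _
    exact (htr s).2
  have h3 : 4 * lam * ∑ s ∈ S, 20 * σ ^ 2 / lam * Real.exp (-(lam ^ 2 / (16 * σ ^ 2)))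
      = 80 * σ ^ 2 * (S.card * Real.exp (-(lam ^ 2 / (16 * σ ^ 2)))) := by
    rw [Finset.sum_const, nsmul_eq_mul]
    field_simp
    ring
  have h4 := mul_le_mul_of_nonneg_left hgle (show 0 ≤ 2 * σ ^ 2 by positivity)
  linarith

/-- The oracle inequality: the expected squared error over the points of an expert is bounded by
the cost of one expert and the deviation of the signal from its mean. -/
theorem integral_sum_aggregate_sub_sq_le (hε : IsNoise μ ε)
    (hρ : IsNonAnticipating μ ε (observation θ σ ε) ρ) (hσ : 0 < σ) (hlam : 0 < lam)
    (hθ : ∀ s, |θ s| ≤ lam / 2) (hσlam : 8 * (σ * Real.sqrt (Real.log N)) ≤ lam) (hS : S ∈ 𝒮) :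
    ∫ ω, ∑ s ∈ S, (aggregate (meanRule K) 𝒮 lam (ρ ω) (observation θ σ ε ω) s - θ s) ^ 2 ∂μ
      ≤ 8 * lam ^ 2 * Real.log (𝒮.card : ℝ) + 8 * lam ^ 2 + 4 * sse S θ := by
  have h𝒮 : 𝒮.Nonempty := ⟨S, hS⟩
  have hne : Nonempty Ω := nonempty_of_isProbabilityMeasure μ
  have hcardS : S.card ≤ N := by
    refine (Finset.card_le_univ S).trans (le_of_eq ?_)
    rw [← Fintype.card_congr (ρ hne.some), Fintype.card_fin]
  have hlogc : 0 ≤ Real.log (𝒮.card : ℝ) := Real.log_nonneg (by exact_mod_cast h𝒮.card_pos)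
  -- For `N ≤ 1` the logarithm vanishes and `hσlam` does not control `σ`; there is at most one
  -- point, with error below `8 λ²`.
  rcases lt_or_ge N 2 with hN | hN
  · have hpt : ∀ ω, ∑ s ∈ S,
        (aggregate (meanRule K) 𝒮 lam (ρ ω) (observation θ σ ε ω) s - θ s) ^ 2 ≤ 8 * lam ^ 2 := by
      intro ω
      have h1 : ∀ s ∈ S, (aggregate (meanRule K) 𝒮 lam (ρ ω) (observation θ σ ε ω) s - θ s) ^ 2
          ≤ 8 * lam ^ 2 := by
        intro s _
        have h1 := abs_le.1 (abs_aggregate_le (meanRule K) (lam := lam) (ρ ω)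
          (observation θ σ ε ω) h𝒮 hlam.le s)
        have h2 := abs_le.1 (hθ s)
        nlinarith
      refine (Finset.sum_le_card_nsmul _ _ _ h1).trans ?_
      rw [nsmul_eq_mul]
      have : (S.card : ℝ) ≤ 1 := by exact_mod_cast (by omega : S.card ≤ 1)
      nlinarith [sq_nonneg lam]
    refine (integral_mono (integrable_finsetSum _ fun s _ =>
      integrable_aggregate_sub_sq hε hρ h𝒮 hlam.le s) (integrable_const _) hpt).trans ?_
    simp only [integral_const, probReal_univ, one_smul]
    have := sse_nonneg S θ
    have : 0 ≤ 8 * lam ^ 2 * Real.log (𝒮.card : ℝ) := by positivity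
    linarith
  · refine (integral_sum_aggregate_sub_sq_le_aux hε hρ hσ hlam hθ hS).trans ?_
    have hN' : (2 : ℝ) ≤ N := by exact_mod_cast hN
    have hlog2 := Real.log_two_gt_d9
    have hlogN : Real.log 2 ≤ Real.log N := Real.log_le_log (by norm_num) hN'
    have hlogN0 : 0 ≤ Real.log N := by linarith
    have hsq : 64 * (σ ^ 2 * Real.log N) ≤ lam ^ 2 := by
      have h0 : 0 ≤ 8 * (σ * Real.sqrt (Real.log N)) := by positivity
      have h1 := mul_self_le_mul_self h0 hσlam
      have h2 := Real.mul_self_sqrt hlogN0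
      nlinarith
    have hσ2 : 0 < σ ^ 2 := by positivity
    -- Because `64 log 2 > 44`. The noise terms then fit into the extra `4 λ²`.
    have hσsq : 44 * σ ^ 2 ≤ lam ^ 2 := by nlinarith
    have hexp : S.card * Real.exp (-(lam ^ 2 / (16 * σ ^ 2))) ≤ 1 := by
      have h1 : Real.exp (-(lam ^ 2 / (16 * σ ^ 2))) ≤ Real.exp (-Real.log N) := by
        rw [Real.exp_le_exp, neg_le_neg_iff, le_div_iff₀ (by positivity)]
        nlinarith
      rw [Real.exp_neg (Real.log N), Real.exp_log (by linarith)] at h1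
      have h2 : (S.card : ℝ) ≤ N := by exact_mod_cast hcardS
      calc _ ≤ (N : ℝ) * (N : ℝ)⁻¹ := by gcongr
        _ = 1 := mul_inv_cancel₀ (by linarith)
    nlinarith [mul_le_mul_of_nonneg_left hexp hσ2.le]

end Oracle

/-! ### Averaging along the coordinates of a box -/

section Averaging

variable {ι α : Type*} [DecidableEq ι] (I : ι → Finset α)

/-- The mean of `f` over the line of the box `∏ i, I i` through `x` in direction `i`. -/
def lineMean (i : ι) (f : (ι → α) → ℝ) (x : ι → α) : ℝ :=
  (∑ v ∈ I i, f (Function.update x i v)) / (I i).card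

section

variable {I}

theorem lineMean_update (i : ι) (f : (ι → α) → ℝ) (x : ι → α) (v : α) :
    lineMean I i f (Function.update x i v) = lineMean I i f x := by
  simp [lineMean]

theorem lineMean_of_invariant {i : ι} (hi : ((I i).card : ℝ) ≠ 0) {f : (ι → α) → ℝ}
    (hf : ∀ x v, f (Function.update x i v) = f x) (x : ι → α) : lineMean I i f x = f x := by
  simp only [lineMean, hf, Finset.sum_const, nsmul_eq_mul]
  field_simp

theorem lineMean_sub (i : ι) (f g : (ι → α) → ℝ) (x : ι → α) :
    lineMean I i (fun x => f x - g x) x = lineMean I i f x - lineMean I i g x := by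
  simp only [lineMean, Finset.sum_sub_distrib, sub_div]

theorem lineMean_const {i : ι} (hi : ((I i).card : ℝ) ≠ 0) (c : ℝ) (x : ι → α) :
    lineMean I i (fun _ => c) x = c := lineMean_of_invariant hi (fun _ _ => rfl) x

theorem lineMean_le {i : ι} {f : (ι → α) → ℝ} {x : ι → α} {c : ℝ} (hi : (0 : ℝ) < (I i).card)
    (h : ∑ v ∈ I i, f (Function.update x i v) ≤ c) : lineMean I i f x ≤ c / (I i).card := by
  unfold lineMean
  gcongr

theorem abs_lineMean_le {i : ι} {f g : (ι → α) → ℝ} {x : ι → α}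
    (h : ∀ v ∈ I i, |f (Function.update x i v)| ≤ g (Function.update x i v)) :
    |lineMean I i f x| ≤ lineMean I i g x := by
  unfold lineMean
  rw [abs_div, Nat.abs_cast]
  gcongr
  exact (Finset.abs_sum_le_sum_abs _ _).trans (Finset.sum_le_sum h)

end

variable [Fintype ι]

theorem update_mem_piFinset {x : ι → α} (hx : x ∈ Fintype.piFinset I) {i : ι} {v : α}
    (hv : v ∈ I i) : Function.update x i v ∈ Fintype.piFinset I := by
  rw [Fintype.mem_piFinset] at hx ⊢
  intro j
  by_cases h : j = i
  · subst h; simpa using hv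
  · simpa [h] using hx j

/-- Exchanging `x i` with `v` is an involution of the index set. It makes averaging along a
coordinate self-adjoint. -/
theorem sum_sum_update_comm (i : ι) (F : (ι → α) → (ι → α) → ℝ) :
    ∑ x ∈ Fintype.piFinset I, ∑ v ∈ I i, F x (Function.update x i v)
      = ∑ x ∈ Fintype.piFinset I, ∑ v ∈ I i, F (Function.update x i v) x := by
  rw [← Finset.sum_product', ← Finset.sum_product']
  refine Finset.sum_bij' (fun p _ => (Function.update p.1 i p.2, p.1 i))
    (fun p _ => (Function.update p.1 i p.2, p.1 i)) ?_ ?_ ?_ ?_ ?_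
  · intro p hp
    rw [Finset.mem_product] at hp ⊢
    exact ⟨update_mem_piFinset I hp.1 hp.2, Fintype.mem_piFinset.1 hp.1 i⟩
  · intro p hp
    rw [Finset.mem_product] at hp ⊢
    exact ⟨update_mem_piFinset I hp.1 hp.2, Fintype.mem_piFinset.1 hp.1 i⟩
  · intro p _; simp
  · intro p _; simp
  · intro p _; simp

variable {I}

theorem card_pos_of_mem_piFinset {x : ι → α} (hx : x ∈ Fintype.piFinset I) (i : ι) :
    (0 : ℝ) < (I i).card := by
  exact_mod_cast Finset.card_pos.2 ⟨x i, Fintype.mem_piFinset.1 hx i⟩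

theorem sum_mul_lineMean (i : ι) (f g : (ι → α) → ℝ) :
    ∑ x ∈ Fintype.piFinset I, f x * lineMean I i g x
      = ∑ x ∈ Fintype.piFinset I, lineMean I i f x * g x := by
  simp only [lineMean, mul_div_assoc', div_mul_eq_mul_div, ← Finset.sum_div, Finset.mul_sum,
    Finset.sum_mul]
  rw [sum_sum_update_comm I i fun x z => f x * g z]

theorem sum_lineMean (i : ι) (hi : ((I i).card : ℝ) ≠ 0) (f : (ι → α) → ℝ) :
    ∑ x ∈ Fintype.piFinset I, lineMean I i f x = ∑ x ∈ Fintype.piFinset I, f x := by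
  have := sum_mul_lineMean (I := I) i (fun _ => 1) f
  simpa [lineMean_const hi] using this

/-- Averaging is an orthogonal projection `A`: by Pythagoras, `‖f - A g‖² = ‖f - A f‖² + ‖A (f -
g)‖²`, and `A` is a contraction. -/
theorem sum_sub_lineMean_sq_le (i : ι) (hi : ((I i).card : ℝ) ≠ 0) (f g : (ι → α) → ℝ) :
    ∑ x ∈ Fintype.piFinset I, (f x - lineMean I i g x) ^ 2
      ≤ ∑ x ∈ Fintype.piFinset I, (f x - lineMean I i f x) ^ 2
        + ∑ x ∈ Fintype.piFinset I, (f x - g x) ^ 2 := by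
  have hidem : ∀ h x, lineMean I i (lineMean I i h) x = lineMean I i h x := fun h x =>
    lineMean_of_invariant hi (lineMean_update i h) x
  have horth : ∀ h k : (ι → α) → ℝ,
      ∑ x ∈ Fintype.piFinset I, (h x - lineMean I i h x) * lineMean I i k x = 0 := by
    intro h k
    rw [sum_mul_lineMean i (fun x => h x - lineMean I i h x)]
    refine Finset.sum_eq_zero fun x _ => ?_
    rw [lineMean_sub, hidem, sub_self, zero_mul]
  set k : (ι → α) → ℝ := fun x => f x - g x with hk
  have h1 : ∑ x ∈ Fintype.piFinset I, (f x - lineMean I i g x) ^ 2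
      = ∑ x ∈ Fintype.piFinset I, (f x - lineMean I i f x) ^ 2
        + ∑ x ∈ Fintype.piFinset I, lineMean I i k x ^ 2 := by
    have := horth f k
    rw [← Finset.sum_add_distrib, ← sub_eq_zero, ← Finset.sum_sub_distrib]
    rw [← mul_eq_zero_of_right 2 this, Finset.mul_sum]
    refine Finset.sum_congr rfl fun x _ => ?_
    rw [hk, lineMean_sub]
    ring
  have h2 : ∑ x ∈ Fintype.piFinset I, lineMean I i k x ^ 2
      ≤ ∑ x ∈ Fintype.piFinset I, k x ^ 2 := by
    have h3 : ∑ x ∈ Fintype.piFinset I, k x ^ 2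
        = ∑ x ∈ Fintype.piFinset I, lineMean I i k x ^ 2
          + ∑ x ∈ Fintype.piFinset I, (k x - lineMean I i k x) ^ 2 := by
      have := horth k k
      rw [← Finset.sum_add_distrib, ← sub_eq_zero, ← Finset.sum_sub_distrib]
      rw [← mul_eq_zero_of_right 2 this, Finset.mul_sum]
      refine Finset.sum_congr rfl fun x _ => ?_
      ring
    rw [h3]
    exact le_add_of_nonneg_right (Finset.sum_nonneg fun _ _ => sq_nonneg _)
  rw [h1]
  linarith

theorem eq_of_forall_update_eq {f : (ι → α) → ℝ} (hf : ∀ i x v, f (Function.update x i v) = f x)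
    (x z : ι → α) : f x = f z := by
  have : ∀ s : Finset ι, f (s.piecewise x z) = f z := by
    intro s
    induction s using Finset.induction with
    | empty => simp
    | insert j s hj ih => rw [Finset.piecewise_insert, hf, ih]
  simpa using this Finset.univ

/-- The Efron–Stein inequality on a box. -/
theorem sse_le_sum_sub_lineMean_sq (f : (ι → α) → ℝ) :
    sse (Fintype.piFinset I) f
      ≤ ∑ i, ∑ x ∈ Fintype.piFinset I, (f x - lineMean I i f x) ^ 2 := by
  rcases (Fintype.piFinset I).eq_empty_or_nonempty with h0 | ⟨x₀, hx₀⟩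
  · simp [h0, sse]
  have hI : ∀ i, ((I i).card : ℝ) ≠ 0 := fun i => (card_pos_of_mem_piFinset hx₀ i).ne'
  -- Coordinates are averaged out one at a time, each adding its own term; once all are gone, a
  -- constant remains, and the mean is the best constant.
  have key : ∀ s : Finset ι, ∃ g : (ι → α) → ℝ, (∀ i ∈ s, ∀ x v, g (Function.update x i v) = g x) ∧
      ∑ x ∈ Fintype.piFinset I, (f x - g x) ^ 2
        ≤ ∑ i ∈ s, ∑ x ∈ Fintype.piFinset I, (f x - lineMean I i f x) ^ 2 := by
    intro s
    induction s using Finset.induction with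
    | empty => exact ⟨f, by simp, by simp⟩
    | insert j s hj ih =>
      obtain ⟨g, hg, hle⟩ := ih
      refine ⟨lineMean I j g, ?_, ?_⟩
      · intro i hi x v
        rcases Finset.mem_insert.1 hi with rfl | hi'
        · exact lineMean_update _ _ _ _
        · have hij : i ≠ j := by rintro rfl; exact hj hi'
          simp only [lineMean]
          congr 1
          refine Finset.sum_congr rfl fun u _ => ?_
          rw [Function.update_comm hij, hg i hi']
      · rw [Finset.sum_insert hj]
        exact (sum_sub_lineMean_sq_le j (hI j) f g).trans (by linarith)
  obtain ⟨g, hg, hle⟩ := key Finset.univ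
  have hconst : ∀ x, g x = g x₀ := fun x =>
    eq_of_forall_update_eq (fun i => hg i (Finset.mem_univ i)) x x₀
  refine (sse_le_sum_sub_sq _ f (g x₀)).trans ?_
  simpa only [hconst] using hle

end Averaging

/-! ### Total variation along the coordinates -/

section Variation

/-- Telescoping between `a` and `b`; convexity of `J` keeps all intermediate points in `J`. -/
theorem abs_sub_le_sum_succ {n : ℕ} {J : Finset (Fin n)}
    (hJ : ∀ a ∈ J, ∀ b ∈ J, ∀ c, a ≤ c → c ≤ b → c ∈ J) (g : Fin n → ℝ) {a b : Fin n}
    (ha : a ∈ J) (hb : b ∈ J) :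
    |g a - g b| ≤ ∑ v ∈ J, ∑ w ∈ J, if (w : ℕ) = (v : ℕ) + 1 then |g v - g w| else 0 := by
  wlog hab : a ≤ b generalizing a b
  · rw [abs_sub_comm]; exact this hb ha (le_of_not_ge hab)
  have hnn : ∀ v : Fin n, 0 ≤ ∑ w ∈ J, if (w : ℕ) = (v : ℕ) + 1 then |g v - g w| else 0 := fun v =>
    Finset.sum_nonneg fun w _ => by split_ifs <;> simp
  have key : ∀ m : ℕ, ∀ b ∈ J, a ≤ b → (b : ℕ) = m →
      |g a - g b| ≤ ∑ v ∈ J.filter (fun v : Fin n => (v : ℕ) < m),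
        ∑ w ∈ J, if (w : ℕ) = (v : ℕ) + 1 then |g v - g w| else 0 := by
    intro m
    induction m with
    | zero =>
      intro b hb hab hbm
      have : a = b := le_antisymm hab (by rw [Fin.le_def, hbm]; exact Nat.zero_le _)
      subst this
      simp
    | succ m ih =>
      intro b hb hab hbm
      rcases hab.eq_or_lt with rfl | hlt
      · rw [sub_self, abs_zero]
        exact Finset.sum_nonneg fun v _ => hnn v
      · have hbn := b.2
        set c : Fin n := ⟨m, by omega⟩ with hc
        have hac : a ≤ c := by rw [Fin.le_def, hc]; rw [Fin.lt_def] at hlt; simp only; omega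
        have hcb : c ≤ b := by rw [Fin.le_def, hc]; simp only; omega
        have hcJ : c ∈ J := hJ a ha b hb c hac hcb
        have h1 := ih c hcJ hac rfl
        have hins : J.filter (fun v : Fin n => (v : ℕ) < m + 1)
            = insert c (J.filter fun v : Fin n => (v : ℕ) < m) := by
          ext v
          simp only [Finset.mem_filter, Finset.mem_insert, Fin.ext_iff, hc]
          constructor
          · rintro ⟨h, h'⟩
            rcases Nat.lt_succ_iff_lt_or_eq.1 h' with h'' | h''
            · exact Or.inr ⟨h, h''⟩
            · exact Or.inl h''
          · rintro (h | ⟨h, h'⟩)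
            · refine ⟨?_, by omega⟩
              have : v = c := Fin.ext h
              rwa [this]
            · exact ⟨h, by omega⟩
        rw [hins, Finset.sum_insert (by simp [hc])]
        have h2 : |g c - g b| ≤ ∑ w ∈ J, if (w : ℕ) = (c : ℕ) + 1 then |g c - g w| else 0 := by
          have := Finset.single_le_sum
            (f := fun w : Fin n => if (w : ℕ) = (c : ℕ) + 1 then |g c - g w| else 0) (s := J)
            (fun w _ => by split_ifs <;> simp) hb
          simpa [hbm, hc] using this
        have h3 := abs_sub_le (g a) (g c) (g b)
        linarith
  exact (key b b hb hab rfl).trans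
    (Finset.sum_le_sum_of_subset_of_nonneg (Finset.filter_subset _ _) fun v _ _ => hnn v)

variable {d n : ℕ} (I : Fin d → Finset (Fin n)) (f : Grid d n → ℝ)

/-- The increment of `f` from `x` to its successor in direction `i` inside the box. -/
def stepVar (i : Fin d) (x : Grid d n) : ℝ :=
  ∑ w ∈ I i, if (w : ℕ) = x i + 1 then |f x - f (Function.update x i w)| else 0

/-- The variation of `f` on the line of the box through `x` in direction `i`. -/
def lineVar (i : Fin d) (x : Grid d n) : ℝ := ∑ v ∈ I i, stepVar I f i (Function.update x i v)

/-- The part of the total variation of `f` on the box that comes from edges in direction `i`. -/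
def dirVar (i : Fin d) : ℝ := ∑ x ∈ Fintype.piFinset I, stepVar I f i x

theorem stepVar_nonneg (i : Fin d) (x : Grid d n) : 0 ≤ stepVar I f i x :=
  Finset.sum_nonneg fun w _ => by split_ifs <;> simp

theorem lineVar_nonneg (i : Fin d) (x : Grid d n) : 0 ≤ lineVar I f i x :=
  Finset.sum_nonneg fun _ _ => stepVar_nonneg I f i _

theorem dirVar_nonneg (i : Fin d) : 0 ≤ dirVar I f i :=
  Finset.sum_nonneg fun _ _ => stepVar_nonneg I f i _

theorem lineVar_update (i : Fin d) (x : Grid d n) (v : Fin n) :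
    lineVar I f i (Function.update x i v) = lineVar I f i x := by
  simp [lineVar]

/-- An oriented edge determines its base point and its direction, so no edge is counted twice. -/
theorem sum_dirVar_le_tvOn : ∑ i, dirVar I f i ≤ tvOn (Fintype.piFinset I) f := by
  classical
  set P : Finset ((_ : Fin d) × (Grid d n × Fin n)) :=
    (Finset.univ.sigma fun i => Fintype.piFinset I ×ˢ I i).filter
      fun q => (q.2.2 : ℕ) = q.2.1 q.1 + 1 with hP
  have h1 : ∑ i, dirVar I f i = ∑ q ∈ P, |f q.2.1 - f (Function.update q.2.1 q.1 q.2.2)| := by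
    rw [hP, Finset.sum_filter, Finset.sum_sigma]
    refine Finset.sum_congr rfl fun i _ => ?_
    rw [Finset.sum_product]
    rfl
  have hmem : ∀ q ∈ P, q.2.1 ∈ Fintype.piFinset I ∧ q.2.2 ∈ I q.1 ∧
      (q.2.2 : ℕ) = q.2.1 q.1 + 1 := by
    intro q hq
    simp only [hP, Finset.mem_filter, Finset.mem_sigma, Finset.mem_product] at hq
    exact ⟨hq.1.2.1, hq.1.2.2, hq.2⟩
  have hinj : Set.InjOn (fun q : (_ : Fin d) × (Grid d n × Fin n) =>
      (q.2.1, Function.update q.2.1 q.1 q.2.2)) P := by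
    rintro ⟨i, x, w⟩ hq ⟨j, x', w'⟩ hq' h
    have h1 := (hmem _ hq).2.2
    have h2 := (hmem _ hq').2.2
    simp only [Prod.mk.injEq] at h h1 h2
    obtain ⟨rfl, h⟩ := h
    have hij : i = j := by
      by_contra hne
      have := congrFun h i
      rw [Function.update_self, Function.update_of_ne hne] at this
      rw [this] at h1
      omega
    subst hij
    have := congrFun h i
    simp only [Function.update_self] at this
    rw [this]
  rw [h1, ← Finset.sum_image (f := fun p : Grid d n × Grid d n => |f p.1 - f p.2|) hinj, tvOn]
  refine Finset.sum_le_sum_of_subset_of_nonneg ?_ fun _ _ _ => abs_nonneg _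
  intro p hp
  rw [Finset.mem_image] at hp
  obtain ⟨q, hq, rfl⟩ := hp
  obtain ⟨h1, h2, h3⟩ := hmem q hq
  rw [Finset.mem_filter, Finset.mem_product]
  refine ⟨⟨h1, update_mem_piFinset I h1 h2⟩, q.1, ?_, fun j hj => ?_⟩
  · simpa using h3
  · simp [hj]

variable {I f}

theorem lineVar_le_dirVar (i : Fin d) {x : Grid d n} (hx : x ∈ Fintype.piFinset I) :
    lineVar I f i x ≤ dirVar I f i := by
  unfold lineVar dirVar
  rw [← Finset.sum_image (f := stepVar I f i) (g := fun v => Function.update x i v)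
    (Function.update_injective x i).injOn]
  refine Finset.sum_le_sum_of_subset_of_nonneg ?_ fun _ _ _ => stepVar_nonneg I f i _
  intro z hz
  obtain ⟨v, hv, rfl⟩ := Finset.mem_image.1 hz
  exact update_mem_piFinset I hx hv

/-- Lines in direction `j` through different points of one line in direction `i` are disjoint. -/
theorem sum_lineVar_update_le {i j : Fin d} (hij : i ≠ j) {x : Grid d n}
    (hx : x ∈ Fintype.piFinset I) :
    ∑ v ∈ I i, lineVar I f j (Function.update x i v) ≤ dirVar I f j := by
  unfold lineVar dirVar
  rw [← Finset.sum_product' (f := fun v u =>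
    stepVar I f j (Function.update (Function.update x i v) j u)),
    ← Finset.sum_image (f := stepVar I f j)
      (g := fun p : Fin n × Fin n => Function.update (Function.update x i p.1) j p.2)]
  · refine Finset.sum_le_sum_of_subset_of_nonneg ?_ fun _ _ _ => stepVar_nonneg I f j _
    intro z hz
    obtain ⟨p, hp, rfl⟩ := Finset.mem_image.1 hz
    rw [Finset.mem_product] at hp
    exact update_mem_piFinset I (update_mem_piFinset I hx hp.1) hp.2
  · rintro ⟨v, u⟩ _ ⟨v', u'⟩ _ h
    have h1 := congrFun h i
    have h2 := congrFun h j
    simp only [Function.update_self, Function.update_of_ne hij] at h1 h2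
    rw [h1, h2]

theorem sum_lineVar (i : Fin d) (hi : ((I i).card : ℝ) ≠ 0) :
    ∑ x ∈ Fintype.piFinset I, lineVar I f i x = (I i).card * dirVar I f i := by
  unfold dirVar
  rw [← sum_lineMean i hi (stepVar I f i), Finset.mul_sum]
  refine Finset.sum_congr rfl fun x _ => ?_
  unfold lineMean lineVar
  field_simp

theorem abs_sub_update_le_lineVar {i : Fin d}
    (hI : ∀ a ∈ I i, ∀ b ∈ I i, ∀ c, a ≤ c → c ≤ b → c ∈ I i) {x : Grid d n} (hx : x i ∈ I i)
    {v : Fin n} (hv : v ∈ I i) : |f x - f (Function.update x i v)| ≤ lineVar I f i x := by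
  have := abs_sub_le_sum_succ hI (fun v => f (Function.update x i v)) hx hv
  simp only [Function.update_eq_self] at this
  refine this.trans (le_of_eq ?_)
  simp [lineVar, stepVar]

theorem abs_sub_lineMean_le_lineVar {i : Fin d}
    (hI : ∀ a ∈ I i, ∀ b ∈ I i, ∀ c, a ≤ c → c ≤ b → c ∈ I i) {x : Grid d n} (hx : x i ∈ I i) :
    |f x - lineMean I i f x| ≤ lineVar I f i x := by
  have hc : ((I i).card : ℝ) ≠ 0 := by exact_mod_cast (Finset.card_pos.2 ⟨_, hx⟩).ne'
  have h1 : f x - lineMean I i f x = lineMean I i (fun z => f x - f z) x := by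
    rw [lineMean_sub, lineMean_const hc]
  rw [h1, ← lineMean_const hc (lineVar I f i x) x]
  exact abs_lineMean_le fun v hv => abs_sub_update_le_lineVar hI hx hv

/-- A bound for one term of the Efron–Stein inequality by the variations in two directions. -/
theorem sum_sub_lineMean_sq_le_dirVar (hI : ∀ i, ∀ a ∈ I i, ∀ b ∈ I i, ∀ c, a ≤ c → c ≤ b → c ∈ I i)
    {i j : Fin d} (hij : i ≠ j) (hcard : (I i).card ≤ 2 * (I j).card) :
    ∑ x ∈ Fintype.piFinset I, (f x - lineMean I i f x) ^ 2
      ≤ 2 * (dirVar I f i * (dirVar I f i + dirVar I f j)) := by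
  rcases (Fintype.piFinset I).eq_empty_or_nonempty with h0 | ⟨x₀, hx₀⟩
  · rw [h0, Finset.sum_empty]
    have := dirVar_nonneg I f i
    have := dirVar_nonneg I f j
    positivity
  have hci := card_pos_of_mem_piFinset hx₀ i
  have hcj := card_pos_of_mem_piFinset hx₀ j
  set g : Grid d n → ℝ := fun x => f x - lineMean I i f x with hg
  have hgV : ∀ x ∈ Fintype.piFinset I, |g x| ≤ lineVar I f i x := fun x hx =>
    abs_sub_lineMean_le_lineVar (hI i) (Fintype.mem_piFinset.1 hx i)
  -- A second bound for the same `g`: compare it with its mean along `j`. Multiplying by `hgV` gives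
  -- products of variations in two directions.
  have hgV' : ∀ x ∈ Fintype.piFinset I, |g x| ≤ lineVar I f j x + lineMean I i (lineVar I f j) x
      + lineMean I j (lineVar I f i) x := by
    intro x hx
    have hx' := Fintype.mem_piFinset.1 hx
    have h1 : |lineMean I j g x| ≤ lineMean I j (lineVar I f i) x :=
      abs_lineMean_le fun v hv => hgV _ (update_mem_piFinset I hx hv)
    have h2 : |g x - lineMean I j g x| ≤ lineVar I f j x + lineMean I i (lineVar I f j) x := by
      have h3 : g x - lineMean I j g x = lineMean I j (fun z => g x - g z) x := by
        rw [lineMean_sub j (fun _ => g x) g, lineMean_const hcj.ne']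
      rw [h3, ← lineMean_const hcj.ne' (lineVar I f j x + lineMean I i (lineVar I f j) x) x]
      refine abs_lineMean_le fun v hv => ?_
      have h4 : g x - g (Function.update x j v) = (f x - f (Function.update x j v))
          - lineMean I i (fun z => f z - f (Function.update z j v)) x := by
        have : lineMean I i f (Function.update x j v)
            = lineMean I i (fun z => f (Function.update z j v)) x := by
          simp only [lineMean]
          congr 1
          refine Finset.sum_congr rfl fun u _ => ?_
          rw [Function.update_comm hij]
        rw [lineMean_sub, ← this]
        simp only [hg]
        ring
      rw [h4]
      refine (abs_sub _ _).trans (add_le_add (abs_sub_update_le_lineVar (hI j) (hx' j) hv) ?_)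
      refine abs_lineMean_le fun u hu => abs_sub_update_le_lineVar (hI j) ?_ hv
      rw [Function.update_of_ne hij.symm]
      exact hx' j
    have := abs_add_le (g x - lineMean I j g x) (lineMean I j g x)
    rw [sub_add_cancel] at this
    linarith
  have hmean1 : ∀ x ∈ Fintype.piFinset I,
      lineMean I i (lineVar I f j) x ≤ dirVar I f j / (I i).card := fun x hx =>
    lineMean_le hci (sum_lineVar_update_le hij hx)
  have hmean2 : ∀ x ∈ Fintype.piFinset I,
      lineMean I j (lineVar I f i) x ≤ dirVar I f i / (I j).card := fun x hx =>
    lineMean_le hcj (sum_lineVar_update_le hij.symm hx)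
  have hA : ∑ x ∈ Fintype.piFinset I, lineVar I f i x * lineMean I i (lineVar I f j) x
      ≤ dirVar I f i * dirVar I f j := by
    calc _ ≤ ∑ x ∈ Fintype.piFinset I, lineVar I f i x * (dirVar I f j / (I i).card) :=
          Finset.sum_le_sum fun x hx =>
            mul_le_mul_of_nonneg_left (hmean1 x hx) (lineVar_nonneg I f i x)
      _ = dirVar I f i * dirVar I f j := by
          rw [← Finset.sum_mul, sum_lineVar i hci.ne']; field_simp
  -- The variation along `i` is constant on lines in direction `i`, so the other factor may be
  -- replaced by its average along `i`.
  have hB : ∑ x ∈ Fintype.piFinset I, lineVar I f i x * lineVar I f j x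
      ≤ dirVar I f i * dirVar I f j := by
    refine le_trans (le_of_eq ?_) hA
    rw [sum_mul_lineMean i (lineVar I f i)]
    refine Finset.sum_congr rfl fun x _ => ?_
    rw [lineMean_of_invariant hci.ne' (lineVar_update I f i)]
  -- The only place where the aspect ratio enters.
  have hC : ∑ x ∈ Fintype.piFinset I, lineVar I f i x * lineMean I j (lineVar I f i) x
      ≤ 2 * dirVar I f i ^ 2 := by
    calc _ ≤ ∑ x ∈ Fintype.piFinset I, lineVar I f i x * (dirVar I f i / (I j).card) :=
          Finset.sum_le_sum fun x hx =>
            mul_le_mul_of_nonneg_left (hmean2 x hx) (lineVar_nonneg I f i x)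
      _ = ((I i).card / (I j).card) * dirVar I f i ^ 2 := by
          rw [← Finset.sum_mul, sum_lineVar i hci.ne']; ring
      _ ≤ 2 * dirVar I f i ^ 2 := by
          gcongr
          rw [div_le_iff₀ hcj]
          exact_mod_cast hcard
  calc ∑ x ∈ Fintype.piFinset I, g x ^ 2
      ≤ ∑ x ∈ Fintype.piFinset I, (lineVar I f i x * lineVar I f j x
        + lineVar I f i x * lineMean I i (lineVar I f j) x
        + lineVar I f i x * lineMean I j (lineVar I f i) x) := by
        refine Finset.sum_le_sum fun x hx => ?_
        rw [← sq_abs, sq, ← mul_add, ← mul_add]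
        exact mul_le_mul (hgV x hx) (hgV' x hx) (abs_nonneg _) (lineVar_nonneg I f i x)
    _ ≤ 2 * (dirVar I f i * (dirVar I f i + dirVar I f j)) := by
        rw [Finset.sum_add_distrib, Finset.sum_add_distrib]
        linarith

/-- A discrete Sobolev–Poincaré inequality with a dimension-free constant, on boxes of bounded
aspect ratio in dimension at least two. -/
theorem sse_le_two_mul_tvOn_sq (hd : 1 < d)
    (hI : ∀ i, ∀ a ∈ I i, ∀ b ∈ I i, ∀ c, a ≤ c → c ≤ b → c ∈ I i)
    (hcard : ∀ i j, (I i).card ≤ 2 * (I j).card) :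
    sse (Fintype.piFinset I) f ≤ 2 * tvOn (Fintype.piFinset I) f ^ 2 := by
  have hnt : Nontrivial (Fin d) := Fin.nontrivial_iff_two_le.2 hd
  choose τ hτ using fun i : Fin d => exists_ne i
  have htv := sum_dirVar_le_tvOn I f
  have hsum0 : 0 ≤ ∑ i, dirVar I f i := Finset.sum_nonneg fun i _ => dirVar_nonneg I f i
  have hpair : ∀ i, dirVar I f i + dirVar I f (τ i) ≤ tvOn (Fintype.piFinset I) f := by
    intro i
    refine le_trans ?_ htv
    rw [← Finset.sum_pair (hτ i).symm]
    exact Finset.sum_le_sum_of_subset_of_nonneg (Finset.subset_univ _)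
      fun j _ _ => dirVar_nonneg I f j
  calc sse (Fintype.piFinset I) f
      ≤ ∑ i, ∑ x ∈ Fintype.piFinset I, (f x - lineMean I i f x) ^ 2 := sse_le_sum_sub_lineMean_sq f
    _ ≤ ∑ i, 2 * (dirVar I f i * tvOn (Fintype.piFinset I) f) := by
        refine Finset.sum_le_sum fun i _ =>
          (sum_sub_lineMean_sq_le_dirVar hI (hτ i).symm (hcard _ _)).trans ?_
        have := mul_le_mul_of_nonneg_left (hpair i) (dirVar_nonneg I f i)
        linarith
    _ = 2 * ((∑ i, dirVar I f i) * tvOn (Fintype.piFinset I) f) := by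
        rw [Finset.sum_mul, Finset.mul_sum]
    _ ≤ 2 * tvOn (Fintype.piFinset I) f ^ 2 := by
        rw [sq]
        gcongr
        exact hsum0.trans htv

/-- On an interval every value differs from the mean by at most the total variation. -/
theorem sse_le_card_mul_tvOn_sq {I : Fin 1 → Finset (Fin n)} {f : Grid 1 n → ℝ}
    (hI : ∀ i, ∀ a ∈ I i, ∀ b ∈ I i, ∀ c, a ≤ c → c ≤ b → c ∈ I i) :
    sse (Fintype.piFinset I) f
      ≤ (Fintype.piFinset I).card * tvOn (Fintype.piFinset I) f ^ 2 := by
  have htv := sum_dirVar_le_tvOn I f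
  rw [Fin.sum_univ_one] at htv
  refine (sse_le_sum_sub_lineMean_sq f).trans ?_
  rw [Fin.sum_univ_one, ← nsmul_eq_mul]
  refine Finset.sum_le_card_nsmul _ _ _ fun x hx => ?_
  rw [← sq_abs]
  have := abs_sub_lineMean_le_lineVar (f := f) (hI 0) (Fintype.mem_piFinset.1 hx 0)
  have := (lineVar_le_dirVar (f := f) 0 hx).trans htv
  gcongr
  linarith

end Variation

/-! ### Dyadic boxes and recursive halving -/

section Dyadic

variable {d k : ℕ}

theorem mem_dyadicInterval {s a : ℕ} {i : Fin (2 ^ k)} :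
    i ∈ dyadicInterval k s a ↔ a * 2 ^ s ≤ (i : ℕ) ∧ (i : ℕ) < (a + 1) * 2 ^ s := by
  simp [dyadicInterval]

theorem dyadicInterval_convex (s a : ℕ) : ∀ u ∈ dyadicInterval k s a, ∀ v ∈ dyadicInterval k s a,
    ∀ c, u ≤ c → c ≤ v → c ∈ dyadicInterval k s a := by
  intro u hu v hv c huc hcv
  rw [mem_dyadicInterval] at *
  rw [Fin.le_def] at huc hcv
  exact ⟨hu.1.trans huc, hcv.trans_lt hv.2⟩

theorem card_dyadicInterval {s a : ℕ} (hs : s ≤ k) (ha : a < 2 ^ (k - s)) :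
    (dyadicInterval k s a).card = 2 ^ s := by
  have hle : (a + 1) * 2 ^ s ≤ 2 ^ k := by
    calc (a + 1) * 2 ^ s ≤ 2 ^ (k - s) * 2 ^ s := Nat.mul_le_mul_right _ ha
      _ = 2 ^ k := by rw [← pow_add, Nat.sub_add_cancel hs]
  have : (dyadicInterval k s a).map Fin.valEmbedding = Finset.Ico (a * 2 ^ s) ((a + 1) * 2 ^ s) := by
    ext m
    simp only [Finset.mem_map, mem_dyadicInterval, Fin.valEmbedding_apply, Finset.mem_Ico]
    constructor
    · rintro ⟨i, hi, rfl⟩; exact hi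
    · intro h; exact ⟨⟨m, h.2.trans_le hle⟩, h, rfl⟩
  rw [← Finset.card_map Fin.valEmbedding, this, Nat.card_Ico, add_mul, one_mul,
    Nat.add_sub_cancel_left]

theorem dyadicInterval_succ (s a : ℕ) :
    dyadicInterval k (s + 1) a = dyadicInterval k s (2 * a) ∪ dyadicInterval k s (2 * a + 1) := by
  ext i
  have h1 : a * 2 ^ (s + 1) = 2 * a * 2 ^ s := by ring
  have h2 : (a + 1) * 2 ^ (s + 1) = (2 * a + 1 + 1) * 2 ^ s := by ring
  have h3 : 2 * a * 2 ^ s ≤ (2 * a + 1) * 2 ^ s := Nat.mul_le_mul_right _ (by omega)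
  have h4 : (2 * a + 1) * 2 ^ s ≤ (2 * a + 1 + 1) * 2 ^ s := Nat.mul_le_mul_right _ (by omega)
  rw [Finset.mem_union, mem_dyadicInterval, mem_dyadicInterval, mem_dyadicInterval, h1, h2]
  omega

theorem disjoint_dyadicInterval (s a : ℕ) :
    Disjoint (dyadicInterval k s (2 * a)) (dyadicInterval k s (2 * a + 1)) := by
  rw [Finset.disjoint_left]
  intro i h1 h2
  rw [mem_dyadicInterval] at h1 h2
  omega

/-- The dyadic box with side lengths `2 ^ s i` and indices `a i`. -/
def dyadicBox (k : ℕ) (s a : Fin d → ℕ) : Finset (Grid d (2 ^ k)) :=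
  Fintype.piFinset fun i => dyadicInterval k (s i) (a i)

theorem card_dyadicBox {s a : Fin d → ℕ} (h : ∀ i, s i ≤ k ∧ a i < 2 ^ (k - s i)) :
    (dyadicBox k s a).card = 2 ^ ∑ i, s i := by
  rw [dyadicBox, Fintype.card_piFinset, ← Finset.prod_pow_eq_pow_sum]
  exact Finset.prod_congr rfl fun i _ => card_dyadicInterval (h i).1 (h i).2

theorem mem_dyadicBox_update {s a : Fin d → ℕ} {i : Fin d} {r b : ℕ} {x : Grid d (2 ^ k)} :
    x ∈ dyadicBox k (Function.update s i r) (Function.update a i b) ↔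
      x i ∈ dyadicInterval k r b ∧ ∀ j ≠ i, x j ∈ dyadicInterval k (s j) (a j) := by
  rw [dyadicBox, Fintype.mem_piFinset]
  constructor
  · intro h
    refine ⟨by simpa using h i, fun j hj => ?_⟩
    simpa [hj] using h j
  · rintro ⟨h1, h2⟩ j
    by_cases hj : j = i
    · subst hj; simpa using h1
    · simpa [hj] using h2 j hj

theorem dyadicBox_halve {s : Fin d → ℕ} (a : Fin d → ℕ) {i : Fin d} {r : ℕ} (hr : s i = r + 1) :
    dyadicBox k s a = dyadicBox k (Function.update s i r) (Function.update a i (2 * a i)) ∪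
      dyadicBox k (Function.update s i r) (Function.update a i (2 * a i + 1)) := by
  ext x
  rw [Finset.mem_union, mem_dyadicBox_update, mem_dyadicBox_update, ← or_and_right,
    ← Finset.mem_union, ← dyadicInterval_succ, ← hr, dyadicBox, Fintype.mem_piFinset]
  constructor
  · exact fun h => ⟨h i, fun j _ => h j⟩
  · rintro ⟨h1, h2⟩ j
    by_cases hj : j = i
    · subst hj; exact h1
    · exact h2 j hj

theorem disjoint_dyadicBox_halves (s a : Fin d → ℕ) (i : Fin d) (r : ℕ) :
    Disjoint (dyadicBox k (Function.update s i r) (Function.update a i (2 * a i)))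
      (dyadicBox k (Function.update s i r) (Function.update a i (2 * a i + 1))) := by
  rw [Finset.disjoint_left]
  intro x h1 h2
  rw [mem_dyadicBox_update] at h1 h2
  exact Finset.disjoint_left.1 (disjoint_dyadicInterval r (a i)) h1.1 h2.1

theorem tvOn_nonneg {n : ℕ} (S : Finset (Grid d n)) (θ : Grid d n → ℝ) : 0 ≤ tvOn S θ :=
  Finset.sum_nonneg fun _ _ => abs_nonneg _

theorem tvOn_add_le {n : ℕ} {S₁ S₂ : Finset (Grid d n)} (h : Disjoint S₁ S₂)
    (θ : Grid d n → ℝ) : tvOn S₁ θ + tvOn S₂ θ ≤ tvOn (S₁ ∪ S₂) θ := by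
  classical
  unfold tvOn
  rw [← Finset.sum_union]
  · refine Finset.sum_le_sum_of_subset_of_nonneg ?_ fun _ _ _ => abs_nonneg _
    intro p
    simp only [Finset.mem_union, Finset.mem_filter, Finset.mem_product]
    tauto
  · rw [Finset.disjoint_left] at h ⊢
    intro p
    simp only [Finset.mem_filter, Finset.mem_product]
    exact fun h1 h2 => h h1.1.1 h2.1.1

theorem tvOn_eq_zero_of_card_le_one {n : ℕ} {S : Finset (Grid d n)} (h : S.card ≤ 1)
    (θ : Grid d n → ℝ) : tvOn S θ = 0 := by
  classical
  unfold tvOn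
  refine Finset.sum_eq_zero fun p hp => ?_
  simp only [Finset.mem_filter, Finset.mem_product] at hp
  rw [Finset.card_le_one.1 h _ hp.1.1 _ hp.1.2, sub_self, abs_zero]

/-- If a sum over a dyadic box with comparable sides is controlled as soon as the variation of `θ`
on the box is small, then halving the longest side repeatedly controls the sum over every such
box. -/
theorem sum_dyadicBox_le (θ φ : Grid d (2 ^ k) → ℝ) {δ M B : ℝ} (hδ : 0 < δ) (hM : 0 ≤ M)
    (hφ : ∀ s a : Fin d → ℕ, (∀ i, s i ≤ k ∧ a i < 2 ^ (k - s i)) → (∀ i j, s i ≤ s j + 1) →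
      tvOn (dyadicBox k s a) θ ≤ δ → ∑ x ∈ dyadicBox k s a, φ x ≤ M + B * (dyadicBox k s a).card)
    (s a : Fin d → ℕ) (hsa : ∀ i, s i ≤ k ∧ a i < 2 ^ (k - s i)) (hbal : ∀ i j, s i ≤ s j + 1) :
    ∑ x ∈ dyadicBox k s a, φ x
      ≤ M * (1 + (∑ i, s i : ℕ) * (tvOn (dyadicBox k s a) θ / δ))
        + B * (dyadicBox k s a).card := by
  generalize hh : ∑ i, s i = h
  induction h generalizing s a with
  | zero =>
    have hcard := card_dyadicBox hsa
    rw [hh, pow_zero] at hcard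
    have h0 := tvOn_eq_zero_of_card_le_one hcard.le θ
    simpa using hφ s a hsa hbal (by rw [h0]; exact hδ.le)
  | succ h ih =>
    have htv0 := tvOn_nonneg (dyadicBox k s a) θ
    rcases le_or_gt (tvOn (dyadicBox k s a) θ) δ with htv | htv
    · refine (hφ s a hsa hbal htv).trans ?_
      have : 0 ≤ M * (((h + 1 : ℕ) : ℝ) * (tvOn (dyadicBox k s a) θ / δ)) := by positivity
      linarith
    · have hne : (Finset.univ : Finset (Fin d)).Nonempty := by
        rw [Finset.nonempty_iff_ne_empty]
        intro h0
        rw [h0, Finset.sum_empty] at hh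
        omega
      obtain ⟨i, -, hi⟩ := Finset.exists_max_image Finset.univ s hne
      obtain ⟨r, hr⟩ : ∃ r, s i = r + 1 := by
        refine Nat.exists_eq_succ_of_ne_zero fun h0 => ?_
        have : ∑ j, s j = 0 := Finset.sum_eq_zero fun j hj => by
          have := hi j hj; omega
        omega
      have hvalid : ∀ b, b = 2 * a i ∨ b = 2 * a i + 1 → ∀ j, Function.update s i r j ≤ k ∧
          Function.update a i b j < 2 ^ (k - Function.update s i r j) := by
        intro b hb j
        by_cases hj : j = i
        · subst hj
          have h1 := hsa j
          rw [hr] at h1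
          simp only [Function.update_self]
          refine ⟨by omega, ?_⟩
          have : k - r = k - (r + 1) + 1 := by omega
          rw [this, pow_succ]
          omega
        · simpa [hj] using hsa j
      -- Shortening the longest side by one dyadic scale keeps all scales within one of each other.
      have hbal' : ∀ j l, Function.update s i r j ≤ Function.update s i r l + 1 := by
        intro j l
        have h1 := hi j (Finset.mem_univ j)
        have h2 := hbal i l
        have h3 := hbal j l
        by_cases hj : j = i <;> by_cases hl : l = i <;> simp [hj, hl] <;> omega
      have hsum : ∑ j, Function.update s i r j = h := by
        have h1 := Finset.add_sum_erase Finset.univ s (Finset.mem_univ i)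
        have h2 := Finset.add_sum_erase Finset.univ (Function.update s i r) (Finset.mem_univ i)
        have h3 : ∑ j ∈ Finset.univ.erase i, Function.update s i r j
            = ∑ j ∈ Finset.univ.erase i, s j :=
          Finset.sum_congr rfl fun j hj => by simp [Finset.ne_of_mem_erase hj]
        rw [Function.update_self] at h2
        omega
      have ih1 := ih _ _ (hvalid (2 * a i) (Or.inl rfl)) hbal' hsum
      have ih2 := ih _ _ (hvalid (2 * a i + 1) (Or.inr rfl)) hbal' hsum
      have hdisj := disjoint_dyadicBox_halves (k := k) s a i r
      have htvadd := tvOn_add_le hdisj θ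
      rw [← dyadicBox_halve a hr] at htvadd
      have hcard := Finset.card_union_of_disjoint hdisj
      rw [← dyadicBox_halve a hr] at hcard
      rw [hcard]
      nth_rw 1 [dyadicBox_halve a hr]
      rw [Finset.sum_union hdisj]
      generalize dyadicBox k (Function.update s i r) (Function.update a i (2 * a i)) = S₁ at *
      generalize dyadicBox k (Function.update s i r) (Function.update a i (2 * a i + 1)) = S₂ at *
      have hdiv : tvOn S₁ θ / δ + tvOn S₂ θ / δ ≤ tvOn (dyadicBox k s a) θ / δ := by
        rw [← add_div]; gcongr
      -- The halves cost two copies of `M`; the second is paid by `V / δ ≥ 1`, which uses up one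
      -- level of depth.
      have hone : 1 ≤ tvOn (dyadicBox k s a) θ / δ := by
        rw [le_div_iff₀ hδ]; linarith
      generalize tvOn (dyadicBox k s a) θ / δ = v at *
      have h1 : M * ((h : ℝ) * (tvOn S₁ θ / δ + tvOn S₂ θ / δ)) ≤ M * (h * v) := by gcongr
      have h2 := mul_le_mul_of_nonneg_left hone hM
      push_cast
      linarith

/-- One coordinate admits `∑ 2^(k - s) = 2^(k+1) - 1` pairs of a scale and an index. -/
theorem card_dyadicRects_le (d k : ℕ) : (dyadicRects d k).card ≤ (2 ^ (k + 1)) ^ d := by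
  classical
  set P : Finset ((_ : ℕ) × ℕ) := (Finset.range (k + 1)).sigma fun s => Finset.range (2 ^ (k - s))
    with hP
  have hPcard : P.card ≤ 2 ^ (k + 1) := by
    rw [hP, Finset.card_sigma]
    simp only [Finset.card_range]
    rw [Finset.sum_flip (fun r => 2 ^ r), Nat.geomSum_eq le_rfl]
    simp
  have hsub : dyadicRects d k ⊆ (Fintype.piFinset fun _ : Fin d => P).image fun q =>
      dyadicBox k (fun i => (q i).1) (fun i => (q i).2) := by
    intro R hR
    rw [dyadicRects, Finset.mem_filter] at hR
    obtain ⟨-, s, a, h, rfl⟩ := hR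
    rw [Finset.mem_image]
    refine ⟨fun i => ⟨s i, a i⟩, ?_, rfl⟩
    rw [Fintype.mem_piFinset]
    intro i
    simp only [hP, Finset.mem_sigma, Finset.mem_range]
    exact ⟨by have := (h i).1; omega, (h i).2⟩
  refine (Finset.card_le_card hsub).trans (Finset.card_image_le.trans ?_)
  rw [Fintype.card_piFinset_const]
  exact Nat.pow_le_pow_left hPcard d

theorem dyadicBox_mem_dyadicRects {s a : Fin d → ℕ} (h : ∀ i, s i ≤ k ∧ a i < 2 ^ (k - s i)) :
    dyadicBox k s a ∈ dyadicRects d k := by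
  classical
  rw [dyadicRects, Finset.mem_filter]
  exact ⟨Finset.mem_univ _, s, a, h, rfl⟩

theorem sse_dyadicBox_le_two_mul (hd : 1 < d) {s a : Fin d → ℕ}
    (h : ∀ i, s i ≤ k ∧ a i < 2 ^ (k - s i)) (hbal : ∀ i j, s i ≤ s j + 1)
    (θ : Grid d (2 ^ k) → ℝ) :
    sse (dyadicBox k s a) θ ≤ 2 * tvOn (dyadicBox k s a) θ ^ 2 := by
  refine sse_le_two_mul_tvOn_sq hd (fun i => dyadicInterval_convex _ _) fun i j => ?_
  rw [card_dyadicInterval (h i).1 (h i).2, card_dyadicInterval (h j).1 (h j).2, ← pow_succ']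
  exact Nat.pow_le_pow_right (by norm_num) (hbal i j)

theorem sse_dyadicBox_le_card_mul (s a : Fin 1 → ℕ) (θ : Grid 1 (2 ^ k) → ℝ) :
    sse (dyadicBox k s a) θ ≤ (dyadicBox k s a).card * tvOn (dyadicBox k s a) θ ^ 2 :=
  sse_le_card_mul_tvOn_sq fun _ => dyadicInterval_convex _ _

end Dyadic

/-! ### The two regimes of the risk bound -/

section Risk

variable {d k : ℕ} {θ φ : Grid d (2 ^ k) → ℝ} {lam L : ℝ}

theorem sum_le_of_one_lt_dim (hd : 1 < d) (hlam : 0 < lam)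
    (hφ : ∀ s a : Fin d → ℕ, (∀ i, s i ≤ k ∧ a i < 2 ^ (k - s i)) →
      ∑ x ∈ dyadicBox k s a, φ x ≤ 20 * (lam ^ 2 * L) + 4 * sse (dyadicBox k s a) θ)
    (hL : d * k * Real.log 2 ≤ L) (hL2 : Real.log 2 ≤ L)
    {s a : Fin d → ℕ} (hsa : ∀ i, s i ≤ k ∧ a i < 2 ^ (k - s i)) (hbal : ∀ i j, s i ≤ s j + 1) :
    ∑ x ∈ dyadicBox k s a, φ x
      ≤ 100 * (lam ^ 2 * L ^ 2 + lam * tvOn (dyadicBox k s a) θ * L ^ (3 / 2 : ℝ)) := by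
  have hlog2 := Real.log_two_gt_d9
  have hL0 : 0 < L := by linarith
  obtain ⟨q, hq, rfl⟩ : ∃ q : ℝ, 0 < q ∧ L = q ^ 2 :=
    ⟨Real.sqrt L, Real.sqrt_pos.2 hL0, (Real.sq_sqrt hL0.le).symm⟩
  have hq3 : (q ^ 2) ^ (3 / 2 : ℝ) = q ^ 3 := by
    rw [← Real.rpow_natCast, ← Real.rpow_mul hq.le, ← Real.rpow_natCast]
    norm_num
  -- At variation `δ = λ √L` the approximation error `4 · 2 δ² = 8 λ² L` is comparable to the cost
  -- `20 λ² L` of one expert, hence `28`.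
  have key := sum_dyadicBox_le θ φ (δ := lam * q) (M := 28 * (lam ^ 2 * q ^ 2)) (B := 0)
    (by positivity) (by positivity) ?_ s a hsa hbal
  · have hh : ((∑ i, s i : ℕ) : ℝ) * Real.log 2 ≤ q ^ 2 := by
      refine le_trans ?_ hL
      gcongr
      have : ∑ i, s i ≤ d * k := by
        refine (Finset.sum_le_card_nsmul _ _ k fun i _ => (hsa i).1).trans ?_
        simp
      exact_mod_cast this
    -- The depth is the base-2 logarithm of the number of points, and `1 / log 2 < 3/2`.
    have hh' : ((∑ i, s i : ℕ) : ℝ) ≤ 3 / 2 * q ^ 2 := by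
      have : (0 : ℝ) ≤ (∑ i, s i : ℕ) := Nat.cast_nonneg _
      nlinarith
    have hV := tvOn_nonneg (dyadicBox k s a) θ
    rw [hq3]
    generalize ((∑ i, s i : ℕ) : ℝ) = h at *
    generalize tvOn (dyadicBox k s a) θ = V at *
    have h1 : 28 * (lam ^ 2 * q ^ 2) * (1 + h * (V / (lam * q)))
        = 28 * (lam ^ 2 * q ^ 2) + 28 * (lam * q * V) * h := by
      field_simp
    have h2 : 28 * (lam * q * V) * h ≤ 28 * (lam * q * V) * (3 / 2 * q ^ 2) := by gcongr
    have h3 : lam ^ 2 * q ^ 2 * 1 ≤ lam ^ 2 * q ^ 2 * (3 / 2 * q ^ 2) := by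
      gcongr; linarith
    have h4 : 0 ≤ lam * V * q ^ 3 := by positivity
    have h5 : 0 ≤ lam ^ 2 * (q ^ 2) ^ 2 := by positivity
    rw [zero_mul, add_zero, h1] at key
    nlinarith
  · intro s a hsa hbal htv
    have h1 := sse_dyadicBox_le_two_mul hd hsa hbal θ
    have h2 := pow_le_pow_left₀ (tvOn_nonneg (dyadicBox k s a) θ) htv 2
    have h3 := hφ s a hsa
    rw [mul_pow] at h2
    linarith

theorem sum_le_of_dim_one {θ φ : Grid 1 (2 ^ k) → ℝ} (hlam : 0 < lam)
    (hφ : ∀ s a : Fin 1 → ℕ, (∀ i, s i ≤ k ∧ a i < 2 ^ (k - s i)) →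
      ∑ x ∈ dyadicBox k s a, φ x ≤ 20 * (lam ^ 2 * L) + 4 * sse (dyadicBox k s a) θ)
    (hL : k * Real.log 2 ≤ L) (hL2 : Real.log 2 ≤ L)
    {s a : Fin 1 → ℕ} (hsa : ∀ i, s i ≤ k ∧ a i < 2 ^ (k - s i)) :
    ∑ x ∈ dyadicBox k s a, φ x
      ≤ 20 * (lam ^ 2 * L) + 34 * (lam ^ (4 / 3 : ℝ) * L ^ (4 / 3 : ℝ)
        * (tvOn (dyadicBox k s a) θ / (dyadicBox k s a).card) ^ (2 / 3 : ℝ)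
        * (dyadicBox k s a).card) := by
  have hlog2 := Real.log_two_gt_d9
  have hL0 : 0 < L := by linarith
  have ht : (0 : ℝ) < (dyadicBox k s a).card := by
    rw [card_dyadicBox hsa]; positivity
  have hbal : ∀ (s : Fin 1 → ℕ) (i j), s i ≤ s j + 1 := by
    intro s i j
    rw [Subsingleton.elim i j]; omega
  have hV := tvOn_nonneg (dyadicBox k s a) θ
  -- For `V = 0` the balancing value of `δ` would be zero, but no partition is needed.
  rcases hV.eq_or_lt with h0 | hVpos
  · have h1 := hφ s a hsa
    have h2 := sse_dyadicBox_le_card_mul s a θ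
    rw [← h0] at h2 ⊢
    rw [zero_div, Real.zero_rpow (by norm_num)]
    linarith
  set t : ℝ := ((dyadicBox k s a).card : ℝ) with htdef
  set V := tvOn (dyadicBox k s a) θ with hVdef
  -- This `δ` balances the cost `λ² L² V / δ` of the pieces with the approximation error `δ² t`. The
  -- constants add up to `20 · 3/2 + 4 = 34`.
  obtain ⟨δ, hδ, hδ3⟩ : ∃ δ : ℝ, 0 < δ ∧ δ ^ 3 = lam ^ 2 * L ^ 2 * (V / t) :=
    ⟨(lam ^ 2 * L ^ 2 * (V / t)) ^ (1 / 3 : ℝ), by positivity, by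
      rw [← Real.rpow_natCast, ← Real.rpow_mul (by positivity)]; norm_num⟩
  have hδ2 : lam ^ (4 / 3 : ℝ) * L ^ (4 / 3 : ℝ) * (V / t) ^ (2 / 3 : ℝ) = δ ^ 2 := by
    have h1 : δ ^ 2 = (δ ^ 3) ^ (2 / 3 : ℝ) := by
      rw [← Real.rpow_natCast δ 3, ← Real.rpow_mul hδ.le, ← Real.rpow_natCast]; norm_num
    have h2 : ∀ x : ℝ, 0 < x → (x ^ 2) ^ (2 / 3 : ℝ) = x ^ (4 / 3 : ℝ) := by
      intro x hx
      rw [← Real.rpow_natCast, ← Real.rpow_mul hx.le]; norm_num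
    rw [h1, hδ3, Real.mul_rpow (by positivity) (by positivity),
      Real.mul_rpow (by positivity) (by positivity), h2 _ hlam, h2 _ hL0]
  have key := sum_dyadicBox_le θ φ (δ := δ) (M := 20 * (lam ^ 2 * L)) (B := 4 * δ ^ 2)
    hδ (by positivity) ?_ s a hsa (hbal s)
  · have hh : ((∑ i, s i : ℕ) : ℝ) * Real.log 2 ≤ L := by
      refine le_trans ?_ hL
      gcongr
      simpa using (hsa 0).1
    have hh' : ((∑ i, s i : ℕ) : ℝ) ≤ 3 / 2 * L := by
      have : (0 : ℝ) ≤ (∑ i, s i : ℕ) := Nat.cast_nonneg _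
      nlinarith
    rw [hδ2]
    rw [← hVdef, ← htdef] at key
    generalize ((∑ i, s i : ℕ) : ℝ) = h at *
    have h1 : lam ^ 2 * L * (h * (V / δ)) ≤ lam ^ 2 * L * (3 / 2 * L * (V / δ)) := by gcongr
    have h2 : lam ^ 2 * L * (3 / 2 * L * (V / δ)) = 3 / 2 * (δ ^ 2 * t) := by
      have : δ ^ 3 * t = lam ^ 2 * L ^ 2 * V := by rw [hδ3]; field_simp
      rw [show lam ^ 2 * L * (3 / 2 * L * (V / δ)) = 3 / 2 * (lam ^ 2 * L ^ 2 * V) / δ by ring,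
        ← this]
      field_simp
    linarith
  · intro s a hsa _ htv
    have h1 := sse_dyadicBox_le_card_mul s a θ
    have h2 := pow_le_pow_left₀ (tvOn_nonneg (dyadicBox k s a) θ) htv 2
    have h3 := hφ s a hsa
    have h4 : ((dyadicBox k s a).card : ℝ) * tvOn (dyadicBox k s a) θ ^ 2
        ≤ (dyadicBox k s a).card * δ ^ 2 := by gcongr
    linarith

/-- After cubing, the claim is the squared hypothesis times `λ⁴ L³ / t³`. It lets the main term
absorb the parametric one. -/
theorem sq_mul_div_le_rpow {V t : ℝ} (hlam : 0 < lam) (hL : 0 < L) (ht : 0 < t)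
    (h : lam ≤ V * Real.sqrt (L * t)) :
    lam ^ 2 * L / t ≤ lam ^ (4 / 3 : ℝ) * L ^ (4 / 3 : ℝ) * (V / t) ^ (2 / 3 : ℝ) := by
  have hV : 0 < V := by
    by_contra hV
    have := mul_nonpos_of_nonpos_of_nonneg (not_lt.1 hV) (Real.sqrt_nonneg (L * t))
    linarith
  have hsq : lam ^ 2 ≤ V ^ 2 * (L * t) := by
    have := pow_le_pow_left₀ hlam.le h 2
    rwa [mul_pow, Real.sq_sqrt (by positivity)] at this
  refine le_of_pow_le_pow_left₀ three_ne_zero (by positivity) ?_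
  have h4 : ∀ x : ℝ, 0 < x → (x ^ (4 / 3 : ℝ)) ^ 3 = x ^ 4 := by
    intro x hx
    rw [← Real.rpow_natCast, ← Real.rpow_mul hx.le, ← Real.rpow_natCast]; norm_num
  have h2 : ((V / t) ^ (2 / 3 : ℝ)) ^ 3 = (V / t) ^ 2 := by
    rw [← Real.rpow_natCast, ← Real.rpow_mul (by positivity), ← Real.rpow_natCast]; norm_num
  rw [mul_pow, mul_pow, h4 _ hlam, h4 _ hL, h2]
  calc (lam ^ 2 * L / t) ^ 3 = lam ^ 4 * L ^ 3 / t ^ 3 * lam ^ 2 := by ring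
    _ ≤ lam ^ 4 * L ^ 3 / t ^ 3 * (V ^ 2 * (L * t)) := by gcongr
    _ = lam ^ 4 * L ^ 4 * (V / t) ^ 2 := by field_simp

variable {Ω : Type*} [MeasurableSpace Ω] {μ : Measure Ω} [IsProbabilityMeasure μ] {σ : ℝ}
  {ε : Grid d (2 ^ k) → Ω → ℝ} {ρ : Ω → (Fin ((2 ^ k) ^ d) ≃ Grid d (2 ^ k))}

theorem dyadicRects_nonempty (d k : ℕ) : (dyadicRects d k).Nonempty :=
  ⟨_, dyadicBox_mem_dyadicRects (s := 0) (a := 0) (by simp)⟩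

theorem integrable_omadre_sub_sq (hε : IsNoise μ ε)
    (hρ : IsNonAnticipating μ ε (observation θ σ ε) ρ) (hlam : 0 < lam) (s : Grid d (2 ^ k)) :
    Integrable (fun ω => (omadre lam (ρ ω) (observation θ σ ε ω) s - θ s) ^ 2) μ :=
  integrable_aggregate_sub_sq hε hρ (dyadicRects_nonempty d k) hlam.le s

/-- The oracle inequality with `log |𝒮| ≤ L`. Since `d > 0` forces `L ≥ log 2`, one has `8 L + 8 ≤
20 L`. -/
theorem sum_integral_omadre_sub_sq_le (hd : 0 < d) (hε : IsNoise μ ε)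
    (hρ : IsNonAnticipating μ ε (observation θ σ ε) ρ) (hσ : 0 < σ) (hlam : 0 < lam)
    (hC : 100 * max (σ * Real.sqrt (Real.log (((2 : ℝ) ^ k) ^ d))) ‖θ‖ ≤ lam)
    {s a : Fin d → ℕ} (hsa : ∀ i, s i ≤ k ∧ a i < 2 ^ (k - s i)) :
    ∑ x ∈ dyadicBox k s a, ∫ ω, (omadre lam (ρ ω) (observation θ σ ε ω) x - θ x) ^ 2 ∂μ
      ≤ 20 * (lam ^ 2 * Real.log (2 ^ d * ((2 : ℝ) ^ k) ^ d)) + 4 * sse (dyadicBox k s a) θ := by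
  have hC1 := (mul_le_mul_of_nonneg_left (le_max_left (σ * Real.sqrt (Real.log (((2 : ℝ) ^ k) ^ d)))
    ‖θ‖) (by norm_num : (0 : ℝ) ≤ 100)).trans hC
  have hC2 := (mul_le_mul_of_nonneg_left (le_max_right (σ * Real.sqrt (Real.log (((2 : ℝ) ^ k) ^ d)))
    ‖θ‖) (by norm_num : (0 : ℝ) ≤ 100)).trans hC
  have hθ : ∀ x, |θ x| ≤ lam / 2 := by
    intro x
    have h1 : |θ x| ≤ ‖θ‖ := norm_le_pi_norm θ x
    have := norm_nonneg θ
    linarith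
  have hσlam : 8 * (σ * Real.sqrt (Real.log (((2 ^ k) ^ d : ℕ) : ℝ))) ≤ lam := by
    push_cast
    have : 0 ≤ σ * Real.sqrt (Real.log (((2 : ℝ) ^ k) ^ d)) := by positivity
    linarith
  have key := integral_sum_aggregate_sub_sq_le hε hρ hσ hlam hθ hσlam
    (dyadicBox_mem_dyadicRects hsa)
  rw [← integral_finsetSum _ fun x _ => integrable_omadre_sub_sq hε hρ hlam x]
  refine key.trans ?_
  have hcard : Real.log ((dyadicRects d k).card : ℝ) ≤ Real.log (2 ^ d * ((2 : ℝ) ^ k) ^ d) := by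
    refine Real.log_le_log (by exact_mod_cast (dyadicRects_nonempty d k).card_pos) ?_
    have h1 : ((dyadicRects d k).card : ℝ) ≤ ((2 : ℝ) ^ (k + 1)) ^ d := by
      exact_mod_cast card_dyadicRects_le d k
    rwa [pow_succ', mul_pow] at h1
  have hone : (1 : ℝ) ≤ ((2 : ℝ) ^ k) ^ d := one_le_pow₀ (one_le_pow₀ one_le_two)
  have hlog2 := Real.log_two_gt_d9
  have hL2 : Real.log 2 ≤ Real.log (2 ^ d * ((2 : ℝ) ^ k) ^ d) := by
    refine Real.log_le_log (by norm_num) ?_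
    have : (2 : ℝ) ^ 1 ≤ 2 ^ d := pow_le_pow_right₀ one_le_two hd
    nlinarith
  have hlam2 : 0 < lam ^ 2 := by positivity
  have h1 := mul_le_mul_of_nonneg_left hcard hlam2.le
  have h2 := mul_le_mul_of_nonneg_left hL2 hlam2.le
  nlinarith

end Risk

end OnlineTV

end

/-! ### The risk bounds on a dyadic square -/

theorem theorem4p2 :
    ∃ C : ℝ, 1 < C ∧
      ∀ (d k : ℕ) (Ω : Type*) [MeasurableSpace Ω] (μ : Measure Ω) [IsProbabilityMeasure μ]
        (θ : OnlineTV.Grid d (2 ^ k) → ℝ) (σ lam : ℝ)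
        (ε : OnlineTV.Grid d (2 ^ k) → Ω → ℝ)
        (ρ : Ω → (Fin ((2 ^ k) ^ d) ≃ OnlineTV.Grid d (2 ^ k)))
        (T : Finset (OnlineTV.Grid d (2 ^ k))) (N L V : ℝ),
        N = ((2 : ℝ) ^ k) ^ d →
        L = Real.log (2 ^ d * N) →
        V = OnlineTV.tvOn T θ →
        0 < σ → 0 < lam →
        C * max (σ * Real.sqrt (Real.log N)) ‖θ‖ ≤ lam →
        OnlineTV.IsNoise μ ε →
        OnlineTV.IsNonAnticipating μ ε (OnlineTV.observation θ σ ε) ρ →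
        OnlineTV.IsDyadicSquare T →
        Integrable (fun ω => ∑ s ∈ T,
          (OnlineTV.omadre lam (ρ ω) (OnlineTV.observation θ σ ε ω) s - θ s) ^ 2) μ ∧
        (1 < d →
          ∫ ω, (1 / (T.card : ℝ)) * ∑ s ∈ T,
              (OnlineTV.omadre lam (ρ ω) (OnlineTV.observation θ σ ε ω) s - θ s) ^ 2 ∂μ
            ≤ C / (T.card : ℝ) * (lam ^ 2 * L ^ 2 + lam * V * L ^ (3 / 2 : ℝ))
              + (σ ^ 2 + lam ^ 2) / (T.card : ℝ) ^ 2) ∧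
        (d = 1 →
          ∫ ω, (1 / (T.card : ℝ)) * ∑ s ∈ T,
              (OnlineTV.omadre lam (ρ ω) (OnlineTV.observation θ σ ε ω) s - θ s) ^ 2 ∂μ
            ≤ C * lam ^ (4 / 3 : ℝ) * L ^ (4 / 3 : ℝ) * (V / (T.card : ℝ)) ^ (2 / 3 : ℝ)
              + C * lam ^ 2 * L / (T.card : ℝ)
              + (σ ^ 2 + lam ^ 2) / (T.card : ℝ) ^ 2) ∧
        (d = 1 → lam ≤ V * Real.sqrt (L * (T.card : ℝ)) →
          ∫ ω, (1 / (T.card : ℝ)) * ∑ s ∈ T,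
              (OnlineTV.omadre lam (ρ ω) (OnlineTV.observation θ σ ε ω) s - θ s) ^ 2 ∂μ
            ≤ C * lam ^ (4 / 3 : ℝ) * L ^ (4 / 3 : ℝ) * (V / (T.card : ℝ)) ^ (2 / 3 : ℝ)
              + (σ ^ 2 + lam ^ 2) / (T.card : ℝ) ^ 2) := by

  -- The value `100` covers the constant for `d > 1`, the pair `34` and `20` for `d = 1`, and their
  -- sum `54` when the parametric term is absorbed.
  refine ⟨100, by norm_num, ?_⟩
  rintro d k Ω _ μ _ θ σ lam ε ρ T N L V rfl rfl rfl hσ hlam hC hε hρ ⟨s₀, a, ⟨hs₀, ha⟩, rfl⟩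
  have hsa : ∀ i : Fin d, (fun _ : Fin d => s₀) i ≤ k ∧ a i < 2 ^ (k - (fun _ : Fin d => s₀) i) :=
    fun i => ⟨hs₀, ha i⟩
  change Integrable (fun ω => ∑ s ∈ OnlineTV.dyadicBox k (fun _ => s₀) a, _) μ ∧ _
  rw [show (Fintype.piFinset fun i => OnlineTV.dyadicInterval k s₀ (a i))
    = OnlineTV.dyadicBox k (fun _ => s₀) a from rfl]
  have hint := OnlineTV.integrable_omadre_sub_sq hε hρ hlam
  have hcard : (0 : ℝ) < (OnlineTV.dyadicBox k (fun _ => s₀) a).card := by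
    rw [OnlineTV.card_dyadicBox hsa]; positivity
  have hint_eq : ∫ ω, (1 / ((OnlineTV.dyadicBox k (fun _ => s₀) a).card : ℝ)) *
      ∑ s ∈ OnlineTV.dyadicBox k (fun _ => s₀) a,
        (OnlineTV.omadre lam (ρ ω) (OnlineTV.observation θ σ ε ω) s - θ s) ^ 2 ∂μ
      = (∑ s ∈ OnlineTV.dyadicBox k (fun _ => s₀) a,
        ∫ ω, (OnlineTV.omadre lam (ρ ω) (OnlineTV.observation θ σ ε ω) s - θ s) ^ 2 ∂μ)
        / (OnlineTV.dyadicBox k (fun _ => s₀) a).card := by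
    rw [integral_const_mul, integral_finsetSum _ fun s _ => hint s, one_div_mul_eq_div]
  have hrest : 0 ≤ (σ ^ 2 + lam ^ 2) / ((OnlineTV.dyadicBox k (fun _ => s₀) a).card : ℝ) ^ 2 := by
    positivity
  rw [hint_eq]
  have hlog2 := Real.log_two_gt_d9
  have hL : Real.log (2 ^ d * ((2 : ℝ) ^ k) ^ d) = d * Real.log 2 + d * k * Real.log 2 := by
    rw [Real.log_mul (by positivity) (by positivity), Real.log_pow, Real.log_pow, Real.log_pow]
    ring
  have hdk : (0 : ℝ) ≤ d * k * Real.log 2 := by positivity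
  have hdim_one : d = 1 →
      (∑ s ∈ OnlineTV.dyadicBox k (fun _ => s₀) a,
        ∫ ω, (OnlineTV.omadre lam (ρ ω) (OnlineTV.observation θ σ ε ω) s - θ s) ^ 2 ∂μ)
        / (OnlineTV.dyadicBox k (fun _ => s₀) a).card
      ≤ 34 * (lam ^ (4 / 3 : ℝ) * Real.log (2 ^ d * ((2 : ℝ) ^ k) ^ d) ^ (4 / 3 : ℝ)
        * (OnlineTV.tvOn (OnlineTV.dyadicBox k (fun _ => s₀) a) θ
          / (OnlineTV.dyadicBox k (fun _ => s₀) a).card) ^ (2 / 3 : ℝ))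
        + 20 * (lam ^ 2 * Real.log (2 ^ d * ((2 : ℝ) ^ k) ^ d)
          / (OnlineTV.dyadicBox k (fun _ => s₀) a).card) := by
    rintro rfl
    rw [div_le_iff₀ hcard]
    have key := OnlineTV.sum_le_of_dim_one (θ := θ) hlam (fun s a h =>
      OnlineTV.sum_integral_omadre_sub_sq_le one_pos hε hρ hσ hlam hC h) ?_ ?_ hsa
    · refine key.trans (le_of_eq ?_)
      field_simp
      ring
    · rw [hL]; push_cast; linarith
    · rw [hL]; push_cast at hdk ⊢; linarith
  refine ⟨integrable_finsetSum _ fun s _ => hint s, fun hd => ?_, fun hd => ?_, fun hd hV => ?_⟩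
  · refine le_trans ?_ (le_add_of_nonneg_right hrest)
    rw [div_mul_eq_mul_div]
    gcongr
    have hd' : (1 : ℝ) ≤ d := by exact_mod_cast hd.le
    refine OnlineTV.sum_le_of_one_lt_dim hd hlam (fun s a h =>
      OnlineTV.sum_integral_omadre_sub_sq_le (by omega) hε hρ hσ hlam hC h) ?_ ?_ hsa
      (fun _ _ => Nat.le_succ _)
    · rw [hL]
      have : 0 ≤ (d : ℝ) * Real.log 2 := by positivity
      linarith
    · rw [hL]
      nlinarith
  · refine le_trans ?_ (le_add_of_nonneg_right hrest)
    refine (hdim_one hd).trans ?_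
    have hL0 : 0 ≤ Real.log (2 ^ d * ((2 : ℝ) ^ k) ^ d) := by
      rw [hL]; positivity
    have hV0 := OnlineTV.tvOn_nonneg (OnlineTV.dyadicBox k (fun _ => s₀) a) θ
    rw [mul_assoc 100, mul_assoc 100, mul_assoc 100 (lam ^ 2), mul_div_assoc 100]
    gcongr <;> norm_num
  · refine le_trans ?_ (le_add_of_nonneg_right hrest)
    refine (hdim_one hd).trans ?_
    have hL0 : 0 < Real.log (2 ^ d * ((2 : ℝ) ^ k) ^ d) := by
      rw [hL, hd]; push_cast; rw [hd] at hdk; push_cast at hdk; linarith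
    have h1 := OnlineTV.sq_mul_div_le_rpow hlam hL0 hcard hV
    have h2 : 0 ≤ lam ^ 2 * Real.log (2 ^ d * ((2 : ℝ) ^ k) ^ d)
      / (OnlineTV.dyadicBox k (fun _ => s₀) a).card := by positivity
    linarith
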